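/- Let $G$ be a finite simple graph on $n \ge 2$ vertices, and let $\overline{G}$ be its complement. For a graph $H$ on $n$ vertices, let $\lambda_1(H) \le \lambda_2(H) \le \cdots \le \lambda_n(H)$ denote the eigenvalues, counted with multiplicity, of its Laplacian matrix $L(H) = D(H) - A(H)$, where $D(H)$ is the diagonal matrix of vertex degrees and $A(H)$ is the adjacency matrix. Then $$\lambda_2(G) + \lambda_2(\overline{G}) \ge 1,$$ and equality holds if and only if $G$ or $\overline{G}$ is isomorphic to the join of an isolated vertex (that is, a one-vertex graph) and a disconnected graph of order $n-1$. Here the join of two graphs is their disjoint union together with all edges between a vertex of the first and a vertex of the second. Moreover (equivalently to the displayed inequality for all such $G$), the Laplacian spread satisfies $$\lambda_n(G) - \lambda_2(G) \le n - 1.$$ -/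

import Mathlib

namespace SimpleGraph

section LaplacianSpectrum

/-- `G.lapEigenvalue i`, for `i = 0, …, n - 1`, is `λ_{i+1}(G)`, where
`λ₁(G) ≤ λ₂(G) ≤ ⋯ ≤ λₙ(G)` are the eigenvalues, with multiplicity, of the real Laplacian matrix
`L = D - A`. (Mathlib's `eigenvalues₀` lists them in decreasing order, hence `Fin.rev`.) -/
noncomputable def lapEigenvalue {V : Type*} [Fintype V] [DecidableEq V] (G : SimpleGraph V)
    [DecidableRel G.Adj] (i : Fin (Fintype.card V)) : ℝ :=
  (G.isHermitian_lapMatrix ℝ).eigenvalues₀ (Fin.rev i)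

/-- The algebraic connectivity `λ(G) = λ₂(G)` of a graph on `n ≥ 2` vertices. -/
noncomputable def algConnectivity {V : Type*} [Fintype V] [DecidableEq V] (G : SimpleGraph V)
    [DecidableRel G.Adj] (hn : 2 ≤ Fintype.card V) : ℝ :=
  G.lapEigenvalue ⟨1, by lia⟩

/-- The Laplacian spread `λₙ(G) - λ₂(G)` of a graph on `n ≥ 2` vertices. -/
noncomputable def lapSpread {V : Type*} [Fintype V] [DecidableEq V] (G : SimpleGraph V)
    [DecidableRel G.Adj] (hn : 2 ≤ Fintype.card V) : ℝ :=
  G.lapEigenvalue ⟨Fintype.card V - 1, by lia⟩ - G.algConnectivity hn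

end LaplacianSpectrum

section Join

/-- The join of two graphs: their disjoint union together with all edges between them. -/
def graphJoin {V W : Type*} (G : SimpleGraph V) (H : SimpleGraph W) : SimpleGraph (V ⊕ W) where
  Adj
    | Sum.inl u, Sum.inl v => G.Adj u v
    | Sum.inr u, Sum.inr v => H.Adj u v
    | Sum.inl _, Sum.inr _ => True
    | Sum.inr _, Sum.inl _ => True
  symm.symm
    | Sum.inl _, Sum.inl _ => G.adj_symm
    | Sum.inr _, Sum.inr _ => H.adj_symm
    | Sum.inl _, Sum.inr _ => id
    | Sum.inr _, Sum.inl _ => id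
  loopless.irrefl
    | Sum.inl u => G.loopless.irrefl u
    | Sum.inr u => H.loopless.irrefl u

/-- The graph `G`, with `n` vertices, is isomorphic to the join of an isolated vertex and a
disconnected graph of order `n - 1`. -/
def IsJoinVertexDisconnected {V : Type*} [Fintype V] (G : SimpleGraph V) : Prop :=
  ∃ H : SimpleGraph (Fin (Fintype.card V - 1)),
    ¬ H.Connected ∧ Nonempty (G ≃g graphJoin (⊥ : SimpleGraph Unit) H)

end Join

end SimpleGraph

/-!
Let `α = λ₂(G)`, `β = λ₂(Gᶜ)`, with unit eigenvectors `x`, `y` orthogonal to the constants. The two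
Laplacians add up to `n` times the projection orthogonal to the constants. Hence `λₙ(G) ≤ n - β`,
so that the bound on the spread follows from `1 ≤ α + β`; and `x ⟂ y` as soon as `α + β < n`.

If `α = 0`, then some level set `C` of `x` has no edges of `G` to its complement, and the complete
bipartite graph between the two, which is part of `Gᶜ`, already gives `β ≥ 1`; for `β = 1` one
side is a single vertex and the rest of `Gᶜ` is disconnected (`one_le_of_eigenvalue_zero`).
Conversely, test vectors show `α = 0` and `β ≤ 1` if `Gᶜ` has this form. The case `β = 0` is
symmetric, so all that remains is to show that `α, β > 0` implies `α + β > 1`. Suppose that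
`α + β ≤ 1`. By the formula for the energy, `(x i - x j) ^ 2 ≤ α < 1` on edges and
`(y i - y j) ^ 2 ≤ β < 1` on non-edges. Since `x` and `y` are orthonormal and orthogonal to the constants, the sum of
`(x i - x j) ^ 2 * (y i - y j) ^ 2` over all pairs is `1 + n * ∑ x i ^ 2 * y i ^ 2`
(`sum_sum_sub_sq_mul_sub_sq`).

If no `x i - x j` and no `y i - y j` exceeds `1` in absolute value, then this sum is at most
`α + β`, since on an edge the product is at most `(x i - x j) ^ 2`, and on a non-edge at most
`(y i - y j) ^ 2`. If only `x` has such gaps, they occur on non-edges that form a star with some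
centre `c`. There the excess `(x c - x j) ^ 2 - 1` is less than
`n ^ 2 / (n - 1) * x c ^ 2 * x j ^ 2` (`card_sub_one_mul_lt`), and the resulting loss
`n ^ 2 / (n - 1) * x c ^ 2 * ∑ x j ^ 2 * (y c - y j) ^ 2` is at most `n * ∑ x j ^ 2 * y j ^ 2` by
the Cauchy–Schwarz inequality (`card_mul_sum_sq_mul_sub_sq_le`). The bound on the excess is strict
because `G` has no isolated vertices; if nothing is lost at all, then `α + β ≤ 1` would force `x`
and `y` to have disjoint supports, which is impossible as well (`false_of_no_gap`).

If both `x` and `y` have gaps larger than `1`, let `α ≤ 1 / 2`, say. The eigenvalue equation at a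
maximum of `x` shows that `x` is at least `(1 - α)` times the maximum on all of its neighbours,
and similarly at the minimum. Since `x` has norm `1`, the maximum or the minimum has a single
neighbour `v` (`exists_pendant`). That extremal vertex is adjacent in `Gᶜ` to everything but `v`,
which forces `v` to be extremal for `y`, and the four extremal vertices to form an induced path of
`G`. Any further vertex makes the energy of `x` or `y` too large, and the path itself has
`α > 1 / 2` (`false_of_gap_of_gap`).
-/

namespace SimpleGraph

/-! ### Spectral description of the Laplacian eigenvalues -/


section Spectral

open Matrix

variable {V : Type*} [Fintype V] (G : SimpleGraph V) [DecidableRel G.Adj]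

/-- The Dirichlet energy of `x`: the sum of `(x i - x j) ^ 2` over the edges `ij` of `G`. It is
written as half of the sum over ordered pairs of adjacent vertices. -/
noncomputable def dirichletEnergy (x : V → ℝ) : ℝ :=
  (∑ i, ∑ j, if G.Adj i j then (x i - x j) ^ 2 else 0) / 2

/-- `x` is a unit vector orthogonal to the constants, and an eigenvector of the Laplacian of `G`
for `μ`. The eigenvalue equation is written out at each vertex. -/
structure IsUnitLapEigenvector (μ : ℝ) (x : V → ℝ) : Prop where
  sum_eq_zero : ∑ i, x i = 0
  sum_sq : ∑ i, x i ^ 2 = 1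
  sum_neighbor : ∀ i, ∑ j ∈ G.neighborFinset i, (x i - x j) = μ * x i

theorem dirichletEnergy_nonneg (x : V → ℝ) : 0 ≤ G.dirichletEnergy x := by
  refine div_nonneg (Finset.sum_nonneg fun i _ => Finset.sum_nonneg fun j _ => ?_) zero_le_two
  split_ifs <;> positivity

variable {G} in
theorem IsUnitLapEigenvector.neg {μ : ℝ} {x : V → ℝ}
    (hx : G.IsUnitLapEigenvector μ x) : G.IsUnitLapEigenvector μ (fun i => - x i) := by
  refine ⟨by simp [hx.sum_eq_zero], by simp [hx.sum_sq], fun i => ?_⟩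
  have := hx.sum_neighbor i
  calc ∑ j ∈ G.neighborFinset i, (- x i - - x j) = - ∑ j ∈ G.neighborFinset i, (x i - x j) := by
        rw [← Finset.sum_neg_distrib]; exact Finset.sum_congr rfl fun j _ => by ring
    _ = μ * - x i := by rw [this]; ring

theorem _root_.IsCompl.adj_iff {V : Type*} {G H : SimpleGraph V} (h : IsCompl G H) (i j : V) :
    H.Adj i j ↔ i ≠ j ∧ ¬ G.Adj i j := by
  rw [← h.compl_eq, compl_adj]

/-- Over the edges of two complementary graphs, the sums of a function vanishing on the diagonal add
up to the sum over all pairs. -/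
theorem _root_.IsCompl.sum_adj_add_sum_adj {G H : SimpleGraph V} [DecidableRel G.Adj]
    [DecidableRel H.Adj] (h : IsCompl G H) (f : V → V → ℝ) (hf : ∀ i, f i i = 0) :
    (∑ i, ∑ j, if G.Adj i j then f i j else 0) + (∑ i, ∑ j, if H.Adj i j then f i j else 0) =
      ∑ i, ∑ j, f i j := by
  simp only [← Finset.sum_add_distrib]
  refine Finset.sum_congr rfl fun i _ => Finset.sum_congr rfl fun j _ => ?_
  have hH := h.adj_iff i j
  by_cases hij : i = j
  · subst hij; simp [hf]
  · by_cases h2 : G.Adj i j <;> simp_all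

theorem sum_sum_sub_sq {z : V → ℝ} (hz : ∑ i, z i = 0) :
    ∑ i, ∑ j, (z i - z j) ^ 2 = 2 * (Fintype.card V * ∑ i, z i ^ 2) := by
  simp only [sub_sq, Finset.sum_add_distrib, Finset.sum_sub_distrib, ← Finset.mul_sum, hz,
    Finset.sum_const, ← Finset.sum_mul, Finset.card_univ, nsmul_eq_mul]
  ring

theorem _root_.IsCompl.dirichletEnergy_add {G H : SimpleGraph V} [DecidableRel G.Adj]
    [DecidableRel H.Adj] (h : IsCompl G H) {z : V → ℝ} (hz : ∑ i, z i = 0) :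
    G.dirichletEnergy z + H.dirichletEnergy z = Fintype.card V * ∑ i, z i ^ 2 := by
  have := h.sum_adj_add_sum_adj (fun i j => (z i - z j) ^ 2) (by simp)
  rw [sum_sum_sub_sq hz] at this
  rw [dirichletEnergy, dirichletEnergy]; linarith

variable [DecidableEq V]

theorem dotProduct_lapMatrix_mulVec_self (x : V → ℝ) :
    x ⬝ᵥ (G.lapMatrix ℝ *ᵥ x) = G.dirichletEnergy x := by
  rw [← toLinearMap₂'_apply', lapMatrix_toLinearMap₂', dirichletEnergy]

theorem lapMatrix_mulVec_eq_sum_sub (x : V → ℝ) (i : V) :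
    (G.lapMatrix ℝ *ᵥ x) i = ∑ j ∈ G.neighborFinset i, (x i - x j) := by
  rw [lapMatrix_mulVec_apply, Finset.sum_sub_distrib, Finset.sum_const,
    card_neighborFinset_eq_degree, nsmul_eq_mul]

theorem dotProduct_lapMatrix_mulVec_comm (x y : V → ℝ) :
    x ⬝ᵥ (G.lapMatrix ℝ *ᵥ y) = (G.lapMatrix ℝ *ᵥ x) ⬝ᵥ y := by
  rw [dotProduct_mulVec, ← mulVec_transpose, (G.isSymm_lapMatrix (R := ℝ)).eq]

theorem IsUnitLapEigenvector.dirichletEnergy_eq {V : Type*} [Fintype V] {G : SimpleGraph V}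
    [DecidableRel G.Adj] {μ : ℝ} {x : V → ℝ} (hx : G.IsUnitLapEigenvector μ x) :
    G.dirichletEnergy x = μ := by
  classical
  rw [← dotProduct_lapMatrix_mulVec_self, dotProduct]
  simp_rw [lapMatrix_mulVec_eq_sum_sub, hx.sum_neighbor]
  calc ∑ i, x i * (μ * x i) = μ * ∑ i, x i ^ 2 := by
        rw [Finset.mul_sum]; exact Finset.sum_congr rfl fun i _ => by ring
    _ = μ := by rw [hx.sum_sq, mul_one]

/-- There is an orthonormal basis of eigenvectors of the Laplacian whose eigenvalues are the
`lapEigenvalue`s, in increasing order. -/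
theorem exists_lapEigenbasis : ∃ e : Fin (Fintype.card V) → V → ℝ,
    (∀ k l, e k ⬝ᵥ e l = if k = l then 1 else 0) ∧
    (∀ k, G.lapMatrix ℝ *ᵥ e k = G.lapEigenvalue k • e k) ∧
    ∀ z w : V → ℝ, ∑ k, (e k ⬝ᵥ z) * (e k ⬝ᵥ w) = z ⬝ᵥ w := by
  set hA := G.isHermitian_lapMatrix ℝ
  set σ : V ≃ Fin (Fintype.card V) := (Fintype.equivOfCardEq (Fintype.card_fin _)).symm
  set b := hA.eigenvectorBasis
  have hin : ∀ z w : V → ℝ, z ⬝ᵥ w = inner ℝ (WithLp.toLp 2 z) (WithLp.toLp 2 w) := fun z w => by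
    rw [EuclideanSpace.inner_eq_star_dotProduct, dotProduct_comm]; simp
  have hb : ∀ i, WithLp.toLp 2 (⇑(b i)) = b i := fun i => rfl
  refine ⟨fun k => ⇑(b (σ.symm k.rev)), fun k l => ?_, fun k => ?_, fun z w => ?_⟩
  · rw [hin, hb, hb, orthonormal_iff_ite.mp b.orthonormal]
    simp [Fin.rev_inj]
  · rw [hA.mulVec_eigenvectorBasis]
    congr 1
    exact congrArg hA.eigenvalues₀ (σ.apply_symm_apply _)
  · rw [hin z w, ← b.sum_inner_mul_inner, ← (Fin.revPerm.trans σ.symm).sum_comp]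
    refine Finset.sum_congr rfl fun k _ => ?_
    rw [hin, hin, hb, real_inner_comm]
    rfl

theorem lapEigenvalue_mono : Monotone G.lapEigenvalue := fun _ _ h =>
  (G.isHermitian_lapMatrix ℝ).eigenvalues₀_antitone (Fin.rev_le_rev.mpr h)

theorem lapEigenvalue_nonneg (k : Fin (Fintype.card V)) : 0 ≤ G.lapEigenvalue k := by
  obtain ⟨e, he, hL, -⟩ := G.exists_lapEigenbasis
  have := G.dotProduct_lapMatrix_mulVec_self (e k)
  rw [hL, dotProduct_smul, he] at this
  simp only [if_true, smul_eq_mul, mul_one] at this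
  exact this ▸ G.dirichletEnergy_nonneg _

theorem algConnectivity_nonneg (hn : 2 ≤ Fintype.card V) : 0 ≤ G.algConnectivity hn :=
  G.lapEigenvalue_nonneg _

theorem one_dotProduct_eq_zero_of_eigen {μ : ℝ} {x : V → ℝ} (hμ : μ ≠ 0)
    (hx : G.lapMatrix ℝ *ᵥ x = μ • x) : (fun _ => 1) ⬝ᵥ x = 0 := by
  have h := G.dotProduct_lapMatrix_mulVec_comm (fun _ => 1) x
  rw [hx, lapMatrix_mulVec_const_eq_zero, zero_dotProduct, dotProduct_smul, smul_eq_mul] at h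
  exact (mul_eq_zero.mp h).resolve_left hμ

theorem isUnitLapEigenvector_of_mulVec {μ : ℝ} {x : V → ℝ} (h0 : (fun _ => 1) ⬝ᵥ x = 0)
    (h1 : x ⬝ᵥ x = 1) (hx : G.lapMatrix ℝ *ᵥ x = μ • x) : G.IsUnitLapEigenvector μ x := by
  refine ⟨by simpa [dotProduct] using h0, by simpa [dotProduct, pow_two] using h1, fun i => ?_⟩
  rw [← lapMatrix_mulVec_eq_sum_sub, hx]; rfl

/-- The second smallest Laplacian eigenvalue has an eigenvector orthogonal to the constants, also
when it vanishes and the eigenvectors of the first two eigenvalues are mixed. -/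
theorem exists_isUnitLapEigenvector_algConnectivity (hn : 2 ≤ Fintype.card V) :
    ∃ x, G.IsUnitLapEigenvector (G.algConnectivity hn) x := by
  obtain ⟨e, he, hL, -⟩ := G.exists_lapEigenbasis
  set k₀ : Fin (Fintype.card V) := ⟨0, by lia⟩
  set k₁ : Fin (Fintype.card V) := ⟨1, by lia⟩
  have hk : k₀ ≠ k₁ := by simp [k₀, k₁]
  change ∃ x, G.IsUnitLapEigenvector (G.lapEigenvalue k₁) x
  by_cases h1 : (fun _ => 1) ⬝ᵥ e k₁ = 0
  · exact ⟨e k₁, G.isUnitLapEigenvector_of_mulVec h1 (by simp [he]) (hL k₁)⟩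
  have hz : G.lapEigenvalue k₁ = 0 := by
    by_contra h
    exact h1 (G.one_dotProduct_eq_zero_of_eigen h (hL k₁))
  have hz0 : G.lapEigenvalue k₀ = 0 :=
    le_antisymm (hz ▸ G.lapEigenvalue_mono (by simp [k₀, k₁, Fin.le_def]))
      (G.lapEigenvalue_nonneg _)
  set r : ℝ := (fun _ => 1) ⬝ᵥ e k₀
  set s : ℝ := (fun _ => 1) ⬝ᵥ e k₁
  have hpos : 0 < s ^ 2 + r ^ 2 := by positivity
  set c : ℝ := (√(s ^ 2 + r ^ 2))⁻¹
  have hc : c ^ 2 * (s ^ 2 + r ^ 2) = 1 := by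
    rw [inv_pow, Real.sq_sqrt hpos.le, inv_mul_cancel₀ hpos.ne']
  refine ⟨c • (s • e k₀ - r • e k₁), G.isUnitLapEigenvector_of_mulVec ?_ ?_ ?_⟩
  · rw [dotProduct_smul, dotProduct_sub, dotProduct_smul, dotProduct_smul]
    simp only [smul_eq_mul]; change c * (s * r - r * s) = 0; ring
  · simp only [dotProduct_smul, smul_dotProduct, dotProduct_sub, sub_dotProduct, he, smul_eq_mul,
      if_true, if_neg hk, if_neg hk.symm]
    linarith
  · simp [mulVec_smul, mulVec_sub, hL, hz, hz0]

/-- Variational lower bound for the energy on the vectors orthogonal to the constants. -/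
theorem algConnectivity_mul_le_dirichletEnergy (hn : 2 ≤ Fintype.card V) {z : V → ℝ}
    (hz : ∑ i, z i = 0) : G.algConnectivity hn * ∑ i, z i ^ 2 ≤ G.dirichletEnergy z := by
  rcases (G.algConnectivity_nonneg hn).eq_or_lt with h0 | h0
  · rw [← h0, zero_mul]; exact G.dirichletEnergy_nonneg z
  obtain ⟨e, he, hL, hP⟩ := G.exists_lapEigenbasis
  set k₀ : Fin (Fintype.card V) := ⟨0, by lia⟩
  have hk : ∀ k, k ≠ k₀ → G.algConnectivity hn ≤ G.lapEigenvalue k := fun k hk =>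
    G.lapEigenvalue_mono (by
      have : k.val ≠ 0 := fun h => hk (Fin.ext h)
      exact Fin.le_def.mpr (by simp; lia))
  have h1 : ∀ k, k ≠ k₀ → e k ⬝ᵥ (fun _ => 1) = 0 := fun k hk' => by
    rw [dotProduct_comm]
    exact G.one_dotProduct_eq_zero_of_eigen (h0.trans_le (hk k hk')).ne' (hL k)
  -- The constants span the first eigenspace, so `z` has no component along `e k₀`.
  have hz0 : e k₀ ⬝ᵥ z = 0 := by
    have h2 := hP (fun _ => 1) z
    have h3 := hP (fun _ => 1) (fun _ => 1)
    rw [Finset.sum_eq_single k₀ (fun k _ hk' => by rw [h1 k hk', zero_mul]) (by simp)] at h2 h3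
    have h4 : (fun _ : V => (1 : ℝ)) ⬝ᵥ z = 0 := by simpa [dotProduct] using hz
    rw [h4] at h2
    refine (mul_eq_zero.mp h2).resolve_left fun h5 => ?_
    rw [h5] at h3
    simp only [mul_zero, dotProduct, mul_one, Finset.sum_const, Finset.card_univ,
      nsmul_eq_mul] at h3
    have h6 : Fintype.card V = 0 := by exact_mod_cast h3.symm
    lia
  have hzz : ∑ i, z i ^ 2 = ∑ k, (e k ⬝ᵥ z) ^ 2 := by
    simpa [dotProduct, pow_two] using (hP z z).symm
  have hE : G.dirichletEnergy z = ∑ k, G.lapEigenvalue k * (e k ⬝ᵥ z) ^ 2 := by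
    rw [← dotProduct_lapMatrix_mulVec_self, ← hP]
    refine Finset.sum_congr rfl fun k _ => ?_
    rw [dotProduct_lapMatrix_mulVec_comm, hL, smul_dotProduct, smul_eq_mul]; ring
  rw [hzz, hE, Finset.mul_sum]
  refine Finset.sum_le_sum fun k _ => ?_
  by_cases h : k = k₀
  · rw [h, hz0]; simp
  · exact mul_le_mul_of_nonneg_right (hk k h) (sq_nonneg _)

theorem algConnectivity_le_of_dirichletEnergy_le (hn : 2 ≤ Fintype.card V) {z : V → ℝ} {μ : ℝ}
    (hz : ∑ i, z i = 0) (i : V) (hi : z i ≠ 0) (h : G.dirichletEnergy z ≤ μ * ∑ i, z i ^ 2) :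
    G.algConnectivity hn ≤ μ := by
  have h1 : 0 < ∑ i, z i ^ 2 :=
    Finset.sum_pos' (fun _ _ => sq_nonneg _) ⟨i, Finset.mem_univ _, by positivity⟩
  exact le_of_mul_le_mul_right ((G.algConnectivity_mul_le_dirichletEnergy hn hz).trans h) h1

/-- The largest Laplacian eigenvalue is at most `n` minus the algebraic connectivity of the
complement. -/
theorem lapSpread_le (hn : 2 ≤ Fintype.card V) {H : SimpleGraph V} [DecidableRel H.Adj]
    (h : IsCompl G H) :
    G.lapSpread hn ≤ Fintype.card V - (G.algConnectivity hn + H.algConnectivity hn) := by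
  set k : Fin (Fintype.card V) := ⟨Fintype.card V - 1, by lia⟩
  suffices H.algConnectivity hn ≤ Fintype.card V - G.lapEigenvalue k by
    change G.lapEigenvalue k - _ ≤ _; linarith
  by_cases h0 : G.lapEigenvalue k = 0
  · obtain ⟨x, hx⟩ := H.exists_isUnitLapEigenvector_algConnectivity hn
    have h1 := h.dirichletEnergy_add hx.sum_eq_zero
    rw [hx.dirichletEnergy_eq, hx.sum_sq] at h1
    have := G.dirichletEnergy_nonneg x
    linarith
  · obtain ⟨e, he, hL, -⟩ := G.exists_lapEigenbasis
    have hx := G.isUnitLapEigenvector_of_mulVec (G.one_dotProduct_eq_zero_of_eigen h0 (hL k))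
      (by simp [he]) (hL k)
    have h1 := h.dirichletEnergy_add hx.sum_eq_zero
    have h2 := H.algConnectivity_mul_le_dirichletEnergy hn hx.sum_eq_zero
    rw [hx.dirichletEnergy_eq, hx.sum_sq] at h1
    rw [hx.sum_sq] at h2
    linarith

end Spectral

/-! ### Graphs with vanishing algebraic connectivity, and cones -/


section ZeroConnectivity

variable {V : Type*} [Fintype V] {G H : SimpleGraph V}

theorem eq_of_preconnected_of_forall_adj {W α : Type*} {K : SimpleGraph W} (hK : K.Preconnected)
    {f : W → α} (hf : ∀ u v, K.Adj u v → f u = f v) (u v : W) : f u = f v := by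
  obtain ⟨p⟩ := hK u v
  induction p with
  | nil => rfl
  | cons h _ ih => exact (hf _ _ h).trans ih

/-- A cone over `c` that carries a nonzero function vanishing at `c`, of total sum zero and constant
along the edges outside `c`, is the join of `c` and a disconnected graph. -/
theorem isJoinVertexDisconnected_of_cone {c : V} (hc : ∀ j, j ≠ c → H.Adj c j) {y : V → ℝ}
    (hyc : y c = 0) (h0 : ∑ i, y i = 0) (h1 : ∑ i, y i ^ 2 = 1)
    (hy : ∀ i j, i ≠ c → j ≠ c → H.Adj i j → y i = y j) : H.IsJoinVertexDisconnected := by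
  classical
  have hcard : Fintype.card {j // j ≠ c} = Fintype.card V - 1 := by simp
  set e : Fin (Fintype.card V - 1) ≃ {j // j ≠ c} := (Fintype.equivFinOfCardEq hcard).symm
  have hbij : Function.Bijective (Sum.elim (fun _ : Unit => c) fun k => (e k : V)) := by
    refine ⟨?_, fun j => ?_⟩
    · rintro (a | a) (b | b) h
      · rfl
      · exact absurd h.symm (e b).2
      · exact absurd h (e a).2
      · exact congrArg Sum.inr (e.injective (Subtype.ext h))
    · by_cases h : j = c
      · exact ⟨Sum.inl (), h.symm⟩
      · exact ⟨Sum.inr (e.symm ⟨j, h⟩), by simp⟩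
  refine ⟨H.comap fun k => (e k : V), fun hcon => ?_, ⟨RelIso.symm ⟨Equiv.ofBijective _ hbij, ?_⟩⟩⟩
  · obtain ⟨k₀⟩ := hcon.nonempty
    have hconst : ∀ j, j ≠ c → y j = y (e k₀) := fun j hj => by
      have := eq_of_preconnected_of_forall_adj hcon.preconnected
        (f := fun k => y (e k)) (fun u v h => hy _ _ (e u).2 (e v).2 h) (e.symm ⟨j, hj⟩) k₀
      simpa using this
    -- The sum of `y` is a positive multiple of this constant.
    have hsum : ∑ i, y i = (Finset.univ.erase c).card * y (e k₀) := by
      rw [← Finset.add_sum_erase _ _ (Finset.mem_univ c), hyc, zero_add,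
        Finset.sum_congr rfl fun j hj => hconst j (Finset.ne_of_mem_erase hj), Finset.sum_const,
        nsmul_eq_mul]
    have hne : ((Finset.univ.erase c).card : ℝ) ≠ 0 := by
      exact_mod_cast (Finset.card_pos.mpr ⟨(e k₀ : V), by simp [(e k₀).2]⟩).ne'
    have hk : y (e k₀) = 0 := (mul_eq_zero.mp (hsum.symm.trans h0)).resolve_left hne
    have hall : ∀ i, y i = 0 := fun i => by
      by_cases h : i = c
      · rw [h, hyc]
      · rw [hconst i h, hk]
    simp [hall] at h1
  · rintro (a | a) (b | b)
    · simp [graphJoin]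
    · simpa [graphJoin] using hc _ (e b).2
    · simpa [graphJoin] using (hc _ (e a).2).symm
    · rfl

variable [DecidableRel G.Adj] [DecidableRel H.Adj]

/-- If every vertex of `C` is adjacent to every vertex outside `C`, then the energy splits into
the contribution of the cut, which is a complete bipartite graph, and that of the two sides. -/
theorem dirichletEnergy_eq_sum_cut_add [DecidableEq V] {C : Finset V}
    (hC : ∀ i ∈ C, ∀ j ∉ C, H.Adj i j) (y : V → ℝ) :
    H.dirichletEnergy y = ∑ i ∈ C, ∑ j ∈ Cᶜ, (y i - y j) ^ 2 +
      (∑ i, ∑ j, if H.Adj i j ∧ (i ∈ C ↔ j ∈ C) then (y i - y j) ^ 2 else 0) / 2 := by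
  have h1 : ∀ i j, (if H.Adj i j then (y i - y j) ^ 2 else 0) =
      (if i ∈ C ∧ j ∈ Cᶜ then (y i - y j) ^ 2 else 0) +
      (if j ∈ C ∧ i ∈ Cᶜ then (y j - y i) ^ 2 else 0) +
      (if H.Adj i j ∧ (i ∈ C ↔ j ∈ C) then (y i - y j) ^ 2 else 0) := by
    intro i j
    by_cases hi : i ∈ C <;> by_cases hj : j ∈ C
    · simp [hi, hj]
    · simp [hi, hj, hC i hi j hj]
    · simp [hi, hj, (hC j hj i hi).symm]; ring
    · simp [hi, hj]
  have h2 : ∑ i, ∑ j, (if i ∈ C ∧ j ∈ Cᶜ then (y i - y j) ^ 2 else 0) =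
      ∑ i ∈ C, ∑ j ∈ Cᶜ, (y i - y j) ^ 2 := by
    simp only [ite_and, Finset.sum_ite_mem, Finset.univ_inter, Finset.sum_ite_irrel,
      Finset.sum_const_zero]
  have h3 : ∑ i, ∑ j, (if j ∈ C ∧ i ∈ Cᶜ then (y j - y i) ^ 2 else 0) =
      ∑ i ∈ C, ∑ j ∈ Cᶜ, (y i - y j) ^ 2 := by
    rw [Finset.sum_comm, h2]
  simp only [dirichletEnergy, h1, Finset.sum_add_distrib, h2, h3]
  ring

theorem sum_sum_compl_sub_sq [DecidableEq V] (C : Finset V) {y : V → ℝ} (h0 : ∑ i, y i = 0)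
    (h1 : ∑ i, y i ^ 2 = 1) :
    ∑ i ∈ C, ∑ j ∈ Cᶜ, (y i - y j) ^ 2 = (Cᶜ.card : ℝ) * ∑ i ∈ C, y i ^ 2 +
      (C.card : ℝ) * (1 - ∑ i ∈ C, y i ^ 2) + 2 * (∑ i ∈ C, y i) ^ 2 := by
  have hs : ∑ i ∈ Cᶜ, y i = - ∑ i ∈ C, y i := by
    linarith [Finset.sum_add_sum_compl C y]
  have hq : ∑ i ∈ Cᶜ, y i ^ 2 = 1 - ∑ i ∈ C, y i ^ 2 := by
    linarith [Finset.sum_add_sum_compl C (fun i => y i ^ 2)]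
  simp only [sub_sq, Finset.sum_add_distrib, Finset.sum_sub_distrib, ← Finset.mul_sum, hs, hq,
    Finset.sum_const, ← Finset.sum_mul, nsmul_eq_mul]
  ring

theorem isJoinVertexDisconnected_of_card_eq_one [DecidableEq V] {C : Finset V}
    (hC : ∀ i ∈ C, ∀ j ∉ C, H.Adj i j) (hcard : C.card = 1) {y : V → ℝ} (h0 : ∑ i, y i = 0)
    (h1 : ∑ i, y i ^ 2 = 1) (hS : ∑ i ∈ C, y i = 0)
    (hE : H.dirichletEnergy y = ∑ i ∈ C, ∑ j ∈ Cᶜ, (y i - y j) ^ 2) :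
    H.IsJoinVertexDisconnected := by
  obtain ⟨c, rfl⟩ := Finset.card_eq_one.mp hcard
  rw [Finset.sum_singleton] at hS
  refine isJoinVertexDisconnected_of_cone (c := c) (fun j hj => hC c (by simp) j (by simpa)) hS
    h0 h1 fun i j hi hj hij => ?_
  rw [dirichletEnergy_eq_sum_cut_add hC, add_eq_left, div_eq_zero_iff,
    or_iff_left two_ne_zero, Finset.sum_eq_zero_iff_of_nonneg fun i _ =>
      Finset.sum_nonneg fun j _ => by split_ifs <;> positivity] at hE
  have h2 := hE i (Finset.mem_univ _)
  rw [Finset.sum_eq_zero_iff_of_nonneg fun j _ => by split_ifs <;> positivity] at h2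
  have h3 := h2 j (Finset.mem_univ _)
  rw [if_pos ⟨hij, by simp [hi, hj]⟩] at h3
  exact sub_eq_zero.mp (pow_eq_zero_iff two_ne_zero |>.mp h3)

/-- If `0` is an eigenvalue of `G` on the complement of the constants, then `G` has no edges
between some level set and its complement. The complementary graph `H` contains all these pairs,
and its energy on them is already at least `1`. -/
theorem one_le_of_eigenvalue_zero [DecidableEq V] (hGH : IsCompl G H) {x y : V → ℝ} {β : ℝ}
    (hx : G.IsUnitLapEigenvector 0 x) (hy : H.IsUnitLapEigenvector β y) :
    1 ≤ β ∧ (β = 1 → H.IsJoinVertexDisconnected) := by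
  have hadj : ∀ i j, G.Adj i j → x i = x j := G.lapMatrix_mulVec_eq_zero_iff_forall_adj.mp <| by
    ext i
    rw [lapMatrix_mulVec_eq_sum_sub, hx.sum_neighbor, zero_mul]; rfl
  obtain ⟨i₀, hi₀⟩ : ∃ i, x i ≠ 0 := by
    by_contra! h
    simpa [h] using hx.sum_sq
  set C : Finset V := Finset.univ.filter fun j => x j = x i₀
  have hcut : ∀ i ∈ C, ∀ j ∉ C, H.Adj i j := by
    intro i hi j hj
    simp only [C, Finset.mem_filter, Finset.mem_univ, true_and] at hi hj
    refine (hGH.adj_iff i j).mpr ⟨fun h => hj (h ▸ hi), fun h => hj ((hadj i j h).symm.trans hi)⟩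
  have hcut' : ∀ i ∈ Cᶜ, ∀ j ∉ Cᶜ, H.Adj i j := fun i hi j hj =>
    (hcut j (by simpa using hj) i (by simpa using hi)).symm
  have hC : 1 ≤ C.card := Finset.card_pos.mpr ⟨i₀, by simp [C]⟩
  have hC' : 1 ≤ Cᶜ.card := by
    refine Finset.card_pos.mpr (Finset.nonempty_iff_ne_empty.mpr fun h => ?_)
    rw [Finset.compl_eq_empty_iff] at h
    have h2 : ∀ j, x j = x i₀ := fun j => by
      have : j ∈ C := h ▸ Finset.mem_univ j
      simpa [C] using this
    have h3 := hx.sum_eq_zero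
    simp only [h2, Finset.sum_const, nsmul_eq_mul] at h3
    refine (mul_ne_zero ?_ hi₀) h3
    exact_mod_cast (Finset.card_pos.mpr ⟨i₀, Finset.mem_univ _⟩).ne'
  have hE := dirichletEnergy_eq_sum_cut_add hcut y
  have hE' := dirichletEnergy_eq_sum_cut_add hcut' y
  have hS := sum_sum_compl_sub_sq C hy.sum_eq_zero hy.sum_sq
  have hS' := sum_sum_compl_sub_sq Cᶜ hy.sum_eq_zero hy.sum_sq
  have hr : ∀ D : Finset V,
      0 ≤ ∑ i, ∑ j, if H.Adj i j ∧ (i ∈ D ↔ j ∈ D) then (y i - y j) ^ 2 else 0 := fun D =>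
    Finset.sum_nonneg fun i _ => Finset.sum_nonneg fun j _ => by split_ifs <;> positivity
  have hcmp : ∑ i ∈ C, y i + ∑ i ∈ Cᶜ, y i = 0 :=
    (Finset.sum_add_sum_compl C y).trans hy.sum_eq_zero
  have ha : ∑ i ∈ C, y i ^ 2 + ∑ i ∈ Cᶜ, y i ^ 2 = 1 :=
    (Finset.sum_add_sum_compl C fun i => y i ^ 2).trans hy.sum_sq
  have ha0 : 0 ≤ ∑ i ∈ C, y i ^ 2 := Finset.sum_nonneg fun i _ => sq_nonneg _
  have ha1 : 0 ≤ ∑ i ∈ Cᶜ, y i ^ 2 := Finset.sum_nonneg fun i _ => sq_nonneg _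
  have h1 := hr C
  have h1' := hr Cᶜ
  rw [compl_compl] at hS' hE'
  have e1 : (1 : ℝ) ≤ C.card := by exact_mod_cast hC
  have e2 : (1 : ℝ) ≤ Cᶜ.card := by exact_mod_cast hC'
  have m1 := mul_nonneg (sub_nonneg.mpr e2) ha0
  have m2 := mul_nonneg (sub_nonneg.mpr e1) ha1
  have hβ := hy.dirichletEnergy_eq
  have s1 := sq_nonneg (∑ i ∈ C, y i)
  have s2 := sq_nonneg (∑ i ∈ Cᶜ, y i)
  have ha' : ∑ i ∈ Cᶜ, y i ^ 2 = 1 - ∑ i ∈ C, y i ^ 2 := by linarith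
  rw [ha'] at m2 hS'
  refine ⟨by linarith, fun hβ1 => ?_⟩
  have z0 : (∑ i ∈ C, y i) ^ 2 = 0 := by linarith
  have z1 : ∑ i ∈ C, y i = 0 := by simpa using z0
  have z2 : ∑ i ∈ Cᶜ, y i = 0 := by linarith
  have z3 : ((Cᶜ.card : ℝ) - 1) * ∑ i ∈ C, y i ^ 2 = 0 := by linarith
  have z4 : ((C.card : ℝ) - 1) * (1 - ∑ i ∈ C, y i ^ 2) = 0 := by linarith
  rcases mul_eq_zero.mp z3 with h | h
  · have hc : Cᶜ.card = 1 := by exact_mod_cast (sub_eq_zero.mp h)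
    refine isJoinVertexDisconnected_of_card_eq_one hcut' hc hy.sum_eq_zero hy.sum_sq z2 ?_
    rw [compl_compl]
    linarith
  · rw [h, sub_zero, mul_one] at z4
    have hc : C.card = 1 := by exact_mod_cast (sub_eq_zero.mp z4)
    refine isJoinVertexDisconnected_of_card_eq_one hcut hc hy.sum_eq_zero hy.sum_sq z1 ?_
    linarith

theorem algConnectivity_eq_zero_of_isolated [DecidableEq V] (hn : 2 ≤ Fintype.card V) {c : V}
    (hc : ∀ j, ¬ G.Adj c j) : G.algConnectivity hn = 0 := by
  refine le_antisymm ?_ (G.algConnectivity_nonneg hn)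
  have hE : G.dirichletEnergy (fun j => if j = c then (Fintype.card V : ℝ) - 1 else -1) = 0 := by
    rw [dirichletEnergy, div_eq_zero_iff]
    left
    refine Finset.sum_eq_zero fun i _ => Finset.sum_eq_zero fun j _ => ?_
    by_cases h : G.Adj i j
    · have hi : i ≠ c := fun e => hc j (e ▸ h)
      have hj : j ≠ c := fun e => hc i (e ▸ h.symm)
      simp [hi, hj]
    · simp [h]
  have hn1 : (2 : ℝ) ≤ Fintype.card V := by exact_mod_cast hn
  refine G.algConnectivity_le_of_dirichletEnergy_le hn
    (z := fun j => if j = c then (Fintype.card V : ℝ) - 1 else -1) ?_ c ?_ ?_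
  · have : ∀ j, (if j = c then (Fintype.card V : ℝ) - 1 else -1) =
        (if j = c then (Fintype.card V : ℝ) else 0) + -1 := fun j => by split_ifs <;> ring
    simp [this, Finset.sum_add_distrib]
  · simp only [if_true]; linarith
  · rw [hE, zero_mul]

/-- On the join of a vertex and a disconnected graph, a function that is constant on the
components of the latter, and zero on the vertex, has Rayleigh quotient `1`. -/
theorem IsJoinVertexDisconnected.algConnectivity_le_one [DecidableEq V] (hn : 2 ≤ Fintype.card V)
    (hH : H.IsJoinVertexDisconnected) :
    (∃ c, ∀ j, j ≠ c → H.Adj c j) ∧ H.algConnectivity hn ≤ 1 := by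
  classical
  obtain ⟨K, hK, ⟨φ⟩⟩ := hH
  set c := φ.symm (Sum.inl ())
  have hφc : φ c = Sum.inl () := φ.apply_symm_apply _
  have hcone : ∀ j, j ≠ c → H.Adj c j := by
    intro j hj
    rw [← φ.map_adj_iff, hφc]
    rcases h : φ j with u | k
    · exact absurd (φ.injective (h.trans hφc.symm)) hj
    · trivial
  refine ⟨⟨c, hcone⟩, ?_⟩
  have hne : Nonempty (Fin (Fintype.card V - 1)) := ⟨⟨0, by lia⟩⟩
  obtain ⟨a, b, hab⟩ : ∃ a b, ¬ K.Reachable a b := by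
    by_contra! h
    exact hK ((connected_iff K).mpr ⟨h, hne⟩)
  set r : ℝ := ((Finset.univ.filter fun k => K.Reachable a k).card : ℝ)
  set s : ℝ := ((Finset.univ.filter fun k => ¬ K.Reachable a k).card : ℝ)
  set w : Fin (Fintype.card V - 1) → ℝ := fun k => if K.Reachable a k then s else -r
  set z : V → ℝ := fun j => Sum.elim (fun _ => 0) w (φ j)
  have hzc : z c = 0 := by simp [z, hφc]
  have hs : 0 < s := by
    exact Nat.cast_pos.mpr (Finset.card_pos.mpr ⟨b, by simp [hab]⟩)
  have hsum : ∑ j, z j = 0 := by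
    have h1 : ∑ j, z j = ∑ t, Sum.elim (fun _ => 0) w t :=
      φ.toEquiv.sum_comp (Sum.elim (fun _ => 0) w)
    rw [h1, Fintype.sum_sum_type]
    simp only [Sum.elim_inl, Sum.elim_inr, Finset.sum_const_zero, zero_add, w, Finset.sum_ite,
      Finset.sum_const, nsmul_eq_mul]
    change r * s + s * -r = 0
    ring
  have hedge : ∀ i j, i ≠ c → j ≠ c → H.Adj i j → z i = z j := by
    intro i j hi hj hij
    rw [← φ.map_adj_iff] at hij
    simp only [z]
    rcases h : φ i with u | k
    · exact absurd (φ.injective (h.trans hφc.symm)) hi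
    rcases h' : φ j with u | l
    · exact absurd (φ.injective (h'.trans hφc.symm)) hj
    rw [h, h'] at hij
    have hkl : K.Adj k l := hij
    have : K.Reachable a k ↔ K.Reachable a l :=
      ⟨fun t => t.trans hkl.reachable, fun t => t.trans hkl.symm.reachable⟩
    simp [w, this]
  refine H.algConnectivity_le_of_dirichletEnergy_le hn hsum (φ.symm (Sum.inr a)) ?_ ?_
  · simp [z, w, hs.ne']
  · have hterm : ∀ i j, (if H.Adj i j then (z i - z j) ^ 2 else 0) =
        (if j = c then z i ^ 2 else 0) + (if i = c then z j ^ 2 else 0) := by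
      intro i j
      by_cases hi : i = c <;> by_cases hj : j = c
      · simp [hi, hj, hzc]
      · simp [hi, hj, hzc, hcone j hj]
      · simp [hi, hj, hzc, (hcone i hi).symm]
      · by_cases h : H.Adj i j
        · simp [hi, hj, h, hedge i j hi hj h]
        · simp [hi, hj, h]
    refine le_of_eq ?_
    simp [dirichletEnergy, hterm, Finset.sum_add_distrib, Finset.sum_ite_irrel]

end ZeroConnectivity

/-! ### Two eigenvectors with gaps larger than one -/


section LargeGaps

variable {V : Type*} [Fintype V] {G H : SimpleGraph V} [DecidableRel G.Adj] [DecidableRel H.Adj]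

/-- A set of distinct edges, each given with one orientation, bounds the energy from below. -/
theorem sum_sub_sq_le_dirichletEnergy (x : V → ℝ) (S : Finset (V × V))
    (hS : ∀ e ∈ S, G.Adj e.1 e.2) (hS' : ∀ e ∈ S, e.swap ∉ S) :
    ∑ e ∈ S, (x e.1 - x e.2) ^ 2 ≤ G.dirichletEnergy x := by
  classical
  have hdisj : Disjoint S (S.map (Equiv.prodComm V V).toEmbedding) := by
    rw [Finset.disjoint_left]
    intro e he he'
    obtain ⟨f, hf, rfl⟩ := Finset.mem_map.mp he'
    exact hS' f hf he
  have hmap : ∑ e ∈ S.map (Equiv.prodComm V V).toEmbedding, (x e.1 - x e.2) ^ 2 =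
      ∑ e ∈ S, (x e.1 - x e.2) ^ 2 := by
    rw [Finset.sum_map]
    exact Finset.sum_congr rfl fun e _ => sub_sq_comm _ _
  have hsub : ∑ e ∈ S.disjUnion _ hdisj, (x e.1 - x e.2) ^ 2 ≤
      ∑ e : V × V, if G.Adj e.1 e.2 then (x e.1 - x e.2) ^ 2 else 0 := by
    rw [← Finset.sum_filter]
    refine Finset.sum_le_sum_of_subset_of_nonneg (fun e he => ?_) fun _ _ _ => sq_nonneg _
    rw [Finset.mem_disjUnion, Finset.mem_map] at he
    rw [Finset.mem_filter]
    refine ⟨Finset.mem_univ _, ?_⟩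
    rcases he with he | ⟨f, hf, rfl⟩
    · exact hS e he
    · exact (hS f hf).symm
  rw [Finset.sum_disjUnion, hmap, Fintype.sum_prod_type] at hsub
  rw [dirichletEnergy]
  linarith

theorem Adj.sub_sq_le_dirichletEnergy (x : V → ℝ) {i j : V} (h : G.Adj i j) :
    (x i - x j) ^ 2 ≤ G.dirichletEnergy x := by
  have := sum_sub_sq_le_dirichletEnergy x {(i, j)} (by simpa using h) (by simp [h.ne])
  simpa using this

namespace IsUnitLapEigenvector

variable {μ : ℝ} {x : V → ℝ} (hx : G.IsUnitLapEigenvector μ x)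
include hx

theorem sub_sq_le {i j : V} (h : G.Adj i j) : (x i - x j) ^ 2 ≤ μ :=
  hx.dirichletEnergy_eq ▸ h.sub_sq_le_dirichletEnergy x

theorem sum_sq_le (S : Finset V) : ∑ i ∈ S, x i ^ 2 ≤ 1 :=
  hx.sum_sq ▸ Finset.sum_le_sum_of_subset_of_nonneg (Finset.subset_univ S)
    fun _ _ _ => sq_nonneg _

theorem pos_of_forall_le {u : V} (hu : ∀ j, x j ≤ x u) : 0 < x u := by
  by_contra! h
  have h0 := (Finset.sum_eq_zero_iff_of_nonpos fun j _ => (hu j).trans h).mp hx.sum_eq_zero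
  have := hx.sum_sq
  simp [fun j => h0 j (Finset.mem_univ j)] at this

theorem neg_of_forall_ge {u : V} (hu : ∀ j, x u ≤ x j) : x u < 0 := by
  have := hx.neg.pos_of_forall_le (u := u) (fun j => neg_le_neg (hu j))
  linarith

theorem sum_sub_le {u : V} (hu : ∀ j, x j ≤ x u) {S : Finset V} (hS : ∀ j ∈ S, G.Adj u j) :
    ∑ j ∈ S, (x u - x j) ≤ μ * x u := by
  rw [← hx.sum_neighbor u]
  exact Finset.sum_le_sum_of_subset_of_nonneg (fun j hj => by simpa using hS j hj)
    fun j _ _ => sub_nonneg.mpr (hu j)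

/-- On the neighbours of a vertex where an eigenvector is maximal, it is at least `1 - μ` times
the maximum. -/
theorem mul_le_of_adj_max {u : V} (hu : ∀ j, x j ≤ x u) {v : V} (h : G.Adj u v) :
    (1 - μ) * x u ≤ x v := by
  have := hx.sum_sub_le hu (S := {v}) (by simpa using h)
  rw [Finset.sum_singleton] at this
  linarith

theorem le_mul_of_adj_min {u : V} (hu : ∀ j, x u ≤ x j) {v : V} (h : G.Adj u v) :
    x v ≤ (1 - μ) * x u := by
  have := hx.neg.mul_le_of_adj_max (fun j => neg_le_neg (hu j)) h
  linarith

theorem sub_add_sub_le {u : V} (hu : ∀ j, x j ≤ x u) {v w : V} (hvw : v ≠ w) (hv : G.Adj u v)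
    (hw : G.Adj u w) : (x u - x v) + (x u - x w) ≤ μ * x u := by
  classical
  have := hx.sum_sub_le hu (S := {v, w}) (by simp [hv, hw])
  rwa [Finset.sum_pair hvw] at this

theorem exists_adj (hμ : μ ≠ 0) {u : V} (hu : x u ≠ 0) : ∃ v, G.Adj u v := by
  by_contra! h
  have h1 := hx.sum_neighbor u
  have h2 : G.neighborFinset u = ∅ := Finset.eq_empty_of_forall_notMem fun j hj =>
    h j (by simpa using hj)
  rw [h2, Finset.sum_empty] at h1
  exact mul_ne_zero hμ hu h1.symm

/-- An eigenvector for a small eigenvalue whose values differ by more than `1` is concentrated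
on its extremal vertices, and one of these has a single neighbour. -/
theorem exists_pendant (hμ0 : 0 < μ) (hμ : μ ≤ 1 / 2) {u i : V} (hu : ∀ j, x j ≤ x u)
    (hi : ∀ j, x i ≤ x j) (hui : 1 < x u - x i) :
    (∃ v, ∀ j, G.Adj u j ↔ j = v) ∨ ∃ v, ∀ j, G.Adj i j ↔ j = v := by
  classical
  have hu0 := hx.pos_of_forall_le hu
  have hi0 := hx.neg_of_forall_ge hi
  by_contra! h
  obtain ⟨v, hv⟩ := hx.exists_adj hμ0.ne' hu0.ne'
  obtain ⟨k, hk⟩ := hx.exists_adj hμ0.ne' hi0.ne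
  obtain ⟨w, hw, hwv⟩ : ∃ w, G.Adj u w ∧ w ≠ v := by
    obtain ⟨w, hw | hw⟩ := h.1 v
    · exact ⟨w, hw⟩
    · exact absurd (hw.2 ▸ hv) hw.1
  obtain ⟨l, hl, hlk⟩ : ∃ l, G.Adj i l ∧ l ≠ k := by
    obtain ⟨l, hl | hl⟩ := h.2 k
    · exact ⟨l, hl⟩
    · exact absurd (hl.2 ▸ hk) hl.1
  have h1 := hx.sub_add_sub_le hu hwv hw hv
  have h2 := hx.neg.sub_add_sub_le (fun j => neg_le_neg (hi j)) hlk hl hk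
  have hv0 := hx.mul_le_of_adj_max hu hv
  have hw0 := hx.mul_le_of_adj_max hu hw
  have hk0 := hx.le_mul_of_adj_min hi hk
  have hl0 := hx.le_mul_of_adj_min hi hl
  have pv : 0 < x v := by nlinarith
  have pw : 0 < x w := by nlinarith
  have pk : x k < 0 := by nlinarith
  have pl : x l < 0 := by nlinarith
  have hsum := hx.sum_sq_le {u, v, w, i, k, l}
  have ne : ∀ {a b : V}, 0 < x a → x b < 0 → a ≠ b := fun ha hb e => by
    rw [e] at ha; linarith
  rw [Finset.sum_insert (by simp [hv.ne, hw.ne, ne hu0 hi0, ne hu0 pk, ne hu0 pl]),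
    Finset.sum_insert (by simp [hwv.symm, ne pv hi0, ne pv pk, ne pv pl]),
    Finset.sum_insert (by simp [ne pw hi0, ne pw pk, ne pw pl]),
    Finset.sum_insert (by simp [hk.ne, hl.ne]), Finset.sum_pair hlk.symm] at hsum
  have e1 : 3 / 2 * x u ≤ x v + x w := by nlinarith
  have e2 : 3 / 2 * -x i ≤ -x k + -x l := by nlinarith
  nlinarith [sq_nonneg (x v - x w), sq_nonneg (x k - x l), sq_nonneg (x u + x i),
    mul_self_le_mul_self (by positivity) e1, mul_self_le_mul_self (by linarith) e2]

/-- Two neighbours `j₁, j₂` of the maximum and one neighbour `r` of the minimum that is adjacent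
to both: these five edges carry an energy of more than `1 / 2 + (1 - μ) ^ 2`, which exceeds `μ` if
`μ ^ 2 < 1 - μ`. -/
theorem false_of_adj_max_min (hμ0 : 0 < μ) (hμ : μ ^ 2 < 1 - μ) {p q j₁ j₂ r : V}
    (hp : ∀ j, x j ≤ x p) (hq : ∀ j, x q ≤ x j) (hpq : 1 < x p - x q) (hj : j₁ ≠ j₂)
    (h₁ : G.Adj p j₁) (h₂ : G.Adj p j₂) (hr : G.Adj q r) (hr₁ : G.Adj r j₁)
    (hr₂ : G.Adj r j₂) : False := by
  classical
  have hp0 := hx.pos_of_forall_le hp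
  have hq0 := hx.neg_of_forall_ge hq
  have hμ1 : μ < 1 := by nlinarith
  have ne : ∀ {a b : V}, 0 < x a → x b < 0 → a ≠ b := fun ha hb e => by
    rw [e] at ha; linarith
  have hj₁0 := hx.mul_le_of_adj_max hp h₁
  have hj₂0 := hx.mul_le_of_adj_max hp h₂
  have hr0 := hx.le_mul_of_adj_min hq hr
  have p₁ : 0 < x j₁ := by nlinarith
  have p₂ : 0 < x j₂ := by nlinarith
  have pr : x r < 0 := by nlinarith
  have hE := sum_sub_sq_le_dirichletEnergy (G := G) x {(p, j₁), (p, j₂), (q, r), (r, j₁), (r, j₂)}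
    (by simp [h₁, h₂, hr, hr₁, hr₂])
    (by simp [h₁.ne, h₂.ne, hr.ne, hr₁.ne, hr₂.ne, h₁.ne', h₂.ne', hr.ne', hr₁.ne', hr₂.ne',
      ne hp0 pr, (ne hp0 pr).symm, ne p₁ hq0, ne p₂ hq0,
      (ne p₁ hq0).symm, (ne p₂ hq0).symm])
  rw [Finset.sum_insert (by simp [hj, ne hp0 hq0, ne hp0 pr]),
    Finset.sum_insert (by simp [ne hp0 hq0, ne hp0 pr]),
    Finset.sum_insert (by simp [hr.ne]),
    Finset.sum_pair (by simp [hj]), hx.dirichletEnergy_eq] at hE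
  have hs := hx.sub_add_sub_le hp hj h₁ h₂
  simp only at hE
  have h3 : (x p - x r) ^ 2 + (x q - x r) ^ 2 ≥ (x p - x q) ^ 2 / 2 := by
    nlinarith [sq_nonneg ((x p - x r) + (x q - x r))]
  have h4 : (1 - μ) * (x p - x q) ≤ x j₁ + x j₂ - x p - x r := by nlinarith
  have h5 : ((1 - μ) * (x p - x q)) ^ 2 ≤ (x j₁ + x j₂ - x p - x r) ^ 2 :=
    pow_le_pow_left₀ (mul_nonneg (by linarith) (by linarith)) h4 2
  have h6 : (x p - x r) ^ 2 + (x j₁ + x j₂ - x p - x r) ^ 2 ≤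
      (x p - x j₁) ^ 2 + (x p - x j₂) ^ 2 + (x r - x j₁) ^ 2 + (x r - x j₂) ^ 2 := by
    nlinarith [sq_nonneg (x j₁ - x j₂)]
  have h7 : 1 < (x p - x q) ^ 2 := by nlinarith
  have h8 : 1 / 2 + (1 - μ) ^ 2 ≤ μ := by
    rw [mul_pow] at h5
    nlinarith [sq_nonneg (1 - μ)]
  have h9 : μ < 0.62 := by nlinarith
  nlinarith

/-- A neighbour `v` of the maximum and a neighbour `k` of the minimum that are adjacent and have a
common neighbour: the five edges have energy more than `1 / 2`. -/
theorem false_of_adj_max_min_triangle (hμ0 : 0 < μ) (hμ : μ ≤ 1 / 2) {u i v k w : V}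
    (hu : ∀ j, x j ≤ x u) (hi : ∀ j, x i ≤ x j) (hui : 1 < x u - x i) (hv : G.Adj u v)
    (hk : G.Adj i k) (hvk : G.Adj v k) (hvw : G.Adj v w) (hwk : G.Adj w k) (hwu : w ≠ u)
    (hwi : w ≠ i) : False := by
  classical
  have hu0 := hx.pos_of_forall_le hu
  have hi0 := hx.neg_of_forall_ge hi
  have ne : ∀ {a b : V}, 0 < x a → x b < 0 → a ≠ b := fun ha hb e => by
    rw [e] at ha; linarith
  have hv0 := hx.mul_le_of_adj_max hu hv
  have hk0 := hx.le_mul_of_adj_min hi hk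
  have pv : 0 < x v := by nlinarith
  have pk : x k < 0 := by nlinarith
  have hE := sum_sub_sq_le_dirichletEnergy (G := G) x {(u, v), (i, k), (v, k), (v, w), (w, k)}
    (by simp [hv, hk, hvk, hvw, hwk])
    (by simp [hv.ne, hk.ne, hvk.ne, hvw.ne, hwk.ne, hv.ne', hk.ne', hvk.ne', hvw.ne', hwk.ne',
      hwu, hwi, hwu.symm, hwi.symm, ne pv hi0, (ne pv hi0).symm,
      ne hu0 pk, (ne hu0 pk).symm])
  rw [Finset.sum_insert (by simp [ne hu0 hi0, hv.ne, hwu.symm]),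
    Finset.sum_insert (by simp [(ne pv hi0).symm, hwi.symm]),
    Finset.sum_insert (by simp [hwk.ne', hvw.ne]),
    Finset.sum_pair (by simp [hvw.ne]), hx.dirichletEnergy_eq] at hE
  simp only at hE
  have h1 : (x v - x k) ^ 2 / 2 ≤ (x v - x w) ^ 2 + (x w - x k) ^ 2 := by
    nlinarith [sq_nonneg ((x v - x w) - (x w - x k))]
  have h2 : ((x u - x v) + (x k - x i)) ^ 2 / 2 ≤ (x u - x v) ^ 2 + (x i - x k) ^ 2 := by
    nlinarith [sq_nonneg ((x u - x v) - (x k - x i))]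
  have h3 : (x u - x i) / 2 ≤ x v - x k := by nlinarith
  have h4 : x v - x k ≤ x u - x i := by linarith [hu v, hi k]
  have h5 : (x u - x i) ^ 2 / 2 ≤
      ((x u - x v) + (x k - x i)) ^ 2 / 2 + 3 / 2 * (x v - x k) ^ 2 := by
    nlinarith [mul_nonneg (sub_nonneg.mpr h3) (sub_nonneg.mpr (hi k)),
      mul_nonneg (sub_nonneg.mpr h3) (by linarith : 0 ≤ x v - x k)]
  nlinarith

end IsUnitLapEigenvector

/-- If `u` has the single neighbour `v` in `G`, then `u` is adjacent in `H` to all vertices but `v`.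
If moreover `v` and `q` are the extremal vertices of `y`, this forces `u, v, q, i` to be an induced
path of `G`, and every further vertex creates too much energy in `G` or in `H`. -/
theorem false_of_pendant_of_gap (hGH : IsCompl G H) {x y : V → ℝ} {α β : ℝ}
    (hx : G.IsUnitLapEigenvector α x) (hy : H.IsUnitLapEigenvector β y) (hα : 0 < α)
    (hβ : 0 < β) (hαβ : α + β ≤ 1) (hα2 : α ≤ 1 / 2) {u i v q : V} (hu : ∀ j, x j ≤ x u)
    (hi : ∀ j, x i ≤ x j) (hui : 1 < x u - x i) (huv : ∀ j, G.Adj u j ↔ j = v)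
    (hv : ∀ j, y j ≤ y v) (hq : ∀ j, y q ≤ y j) (hvq : 1 < y v - y q) : False := by
  classical
  have hadj := hGH.adj_iff
  have hu0 := hx.pos_of_forall_le hu
  have hi0 := hx.neg_of_forall_ge hi
  have hv0 := hy.pos_of_forall_le hv
  have hq0 := hy.neg_of_forall_ge hq
  have hα1 : 0 < 1 - α := by linarith
  have hβ1 : 0 < 1 - β := by linarith
  have hNu : ∀ {j}, G.Adj u j → 0 < x j := fun h =>
    (mul_pos hα1 hu0).trans_le (hx.mul_le_of_adj_max hu h)
  have hNi : ∀ {j}, G.Adj i j → x j < 0 := fun h =>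
    (hx.le_mul_of_adj_min hi h).trans_lt (mul_neg_of_pos_of_neg hα1 hi0)
  have hNv : ∀ {j}, H.Adj v j → 0 < y j := fun h =>
    (mul_pos hβ1 hv0).trans_le (hy.mul_le_of_adj_max hv h)
  have hNq : ∀ {j}, H.Adj q j → y j < 0 := fun h =>
    (hy.le_mul_of_adj_min hq h).trans_lt (mul_neg_of_pos_of_neg hβ1 hq0)
  have guv : G.Adj u v := (huv v).mpr rfl
  have hvq' : v ≠ q := by rintro rfl; linarith
  -- A pair of extremal vertices whose values differ by more than `1` is not an edge.
  have gvq : G.Adj v q := by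
    by_contra h
    have := hy.sub_sq_le ((hadj v q).mpr ⟨hvq', h⟩)
    nlinarith
  have hui' : ¬ G.Adj u i := fun h => by
    have := hx.sub_sq_le h
    nlinarith
  have huu : ∀ {j}, j ≠ u → j ≠ v → H.Adj u j := fun h1 h2 =>
    (hadj _ _).mpr ⟨h1.symm, fun h => h2 ((huv _).mp h)⟩
  have hqu : q ≠ u := by
    rintro rfl
    obtain ⟨j, hj⟩ := hy.exists_adj hβ.ne' hv0.ne'
    have hjq : j ≠ q := by
      rintro rfl
      exact ((hadj _ _).mp hj).2 gvq
    exact (hNv hj).not_gt (hNq (huu hjq hj.ne'))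
  have huq : H.Adj u q := huu hqu hvq'.symm
  have hiu : i ≠ u := by rintro rfl; linarith
  have hiv : i ≠ v := by rintro rfl; linarith [hNu guv]
  have hHui : H.Adj u i := huu hiu hiv
  have hHvi : H.Adj v i := (hadj _ _).mpr ⟨hiv.symm, fun h => (hNu guv).not_gt (hNi h.symm)⟩
  have hiq : i ≠ q := by rintro rfl; linarith [hNv hHvi]
  have giq : G.Adj i q := by
    by_contra h
    exact (hNv hHvi).not_gt (hNq ((hadj q i).mpr ⟨hiq.symm, fun h' => h h'.symm⟩))
  have hcross : ∀ {j}, G.Adj i j → (1 - α) ^ 2 < (x v - x j) ^ 2 := fun {j} h => by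
    have h1 := hx.mul_le_of_adj_max hu guv
    have h2 := hx.le_mul_of_adj_min hi h
    refine pow_lt_pow_left₀ ?_ hα1.le two_ne_zero
    nlinarith
  have hβ2 : β ^ 2 < 1 - β := by
    have h1 := hcross giq
    have h2 := hx.sub_sq_le gvq
    have h3 : β ^ 2 ≤ (1 - α) ^ 2 := pow_le_pow_left₀ hβ.le (by linarith) 2
    linarith
  by_cases hw : ∃ w, w ≠ u ∧ w ≠ v ∧ w ≠ q ∧ w ≠ i
  · obtain ⟨w, hwu, hwv, hwq, hwi⟩ := hw
    have hHuw : H.Adj u w := huu hwu hwv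
    by_cases gvw : G.Adj v w
    · by_cases giw : G.Adj i w
      · have hE := sum_sub_sq_le_dirichletEnergy (G := G) x {(v, q), (v, w)}
          (by simp [gvq, gvw]) (by simp [hvq'.symm, hwv])
        rw [Finset.sum_pair (by simp [hwq.symm]), hx.dirichletEnergy_eq] at hE
        have h1 := hcross giq
        have h2 := hcross giw
        simp only at hE
        nlinarith
      have hHiw : H.Adj i w := (hadj _ _).mpr ⟨hwi.symm, giw⟩
      by_cases gwq : G.Adj w q
      · exact hx.false_of_adj_max_min_triangle hα hα2 hu hi hui guv giq gvq gvw gwq hwu hwi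
      · exact hy.neg.false_of_adj_max_min hβ hβ2 (fun j => neg_le_neg (hq j))
          (fun j => neg_le_neg (hv j)) (by linarith) hwu.symm huq.symm
          ((hadj _ _).mpr ⟨hwq.symm, fun h => gwq h.symm⟩) hHvi hHui.symm hHiw
    · exact hy.false_of_adj_max_min hβ hβ2 hv hq hvq hwi.symm hHvi
        ((hadj _ _).mpr ⟨hwv.symm, gvw⟩) huq.symm hHui hHuw
  -- Otherwise `G` is the path with vertices `u, v, q, i`, and `α ^ 2 - 4 * α + 2 = 0`.
  · push Not at hw
    have hall : ∀ w, w = u ∨ w = v ∨ w = q ∨ w = i := fun w => by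
      by_cases h1 : w = u; · exact .inl h1
      by_cases h2 : w = v; · exact .inr (.inl h2)
      by_cases h3 : w = q; · exact .inr (.inr (.inl h3))
      exact .inr (.inr (.inr (hw w h1 h2 h3)))
    have huniv : (Finset.univ : Finset V) = {u, v, q, i} := by
      ext w; simpa using hall w
    have gvi : ¬ G.Adj v i := ((hadj _ _).mp hHvi).2
    have Nu : G.neighborFinset u = {v} := by
      ext w; simp [huv]
    have Nv : G.neighborFinset v = {u, q} := by
      ext w
      rcases hall w with h | h | h | h <;> rw [h] <;>
        simp [guv.symm, gvq, gvi, hiu, hiq, hvq', guv.ne']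
    have Ni : G.neighborFinset i = {q} := by
      ext w
      rcases hall w with h | h | h | h <;> rw [h] <;>
        simp [giq, hiq, hqu.symm, hvq', G.adj_comm i, hui', gvi]
    have e1 := hx.sum_neighbor u
    have e2 := hx.sum_neighbor v
    have e3 := hx.sum_neighbor i
    have e4 := hx.sum_eq_zero
    rw [Nu, Finset.sum_singleton] at e1
    rw [Nv, Finset.sum_pair hqu.symm] at e2
    rw [Ni, Finset.sum_singleton] at e3
    rw [huniv, Finset.sum_insert (by simp [guv.ne, hqu.symm, hiu.symm]),
      Finset.sum_insert (by simp [hvq', hiv.symm]), Finset.sum_pair hiq.symm] at e4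
    have f1 : x v = (1 - α) * x u := by linarith
    have f2 : x q = (1 - α) * x i := by linarith
    have f3 : x i = - x u := by
      have : (2 - α) * (x u + x i) = 0 := by rw [f1, f2] at e4; linarith
      have := (mul_eq_zero.mp this).resolve_left (by linarith)
      linarith
    have f4 : (α ^ 2 - 4 * α + 2) * x u = 0 := by
      rw [f2, f3, f1] at e2; linarith
    have := (mul_eq_zero.mp f4).resolve_right hu0.ne'
    nlinarith

theorem exists_forall_le_forall_ge {x : V → ℝ} (h : ∃ i j, 1 < x i - x j) :
    ∃ u i, (∀ j, x j ≤ x u) ∧ (∀ j, x i ≤ x j) ∧ 1 < x u - x i := by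
  obtain ⟨a, b, hab⟩ := h
  obtain ⟨u, -, hu⟩ := Finset.exists_max_image Finset.univ x ⟨a, Finset.mem_univ a⟩
  obtain ⟨i, -, hi⟩ := Finset.exists_min_image Finset.univ x ⟨a, Finset.mem_univ a⟩
  exact ⟨u, i, fun j => hu j (Finset.mem_univ j), fun j => hi j (Finset.mem_univ j), by
    linarith [hu a (Finset.mem_univ a), hi b (Finset.mem_univ b)]⟩

/-- The vertex with a single neighbour `v` in `G` given by `exists_pendant` is adjacent in `H` to
both extremal vertices of `y`, which is impossible unless `v` is one of them. -/
theorem false_of_gap_of_gap_of_le_half (hGH : IsCompl G H) {x y : V → ℝ} {α β : ℝ}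
    (hx : G.IsUnitLapEigenvector α x) (hy : H.IsUnitLapEigenvector β y) (hα : 0 < α)
    (hβ : 0 < β) (hαβ : α + β ≤ 1) (hα2 : α ≤ 1 / 2) (hxg : ∃ i j, 1 < x i - x j)
    (hyg : ∃ i j, 1 < y i - y j) : False := by
  -- After a change of sign of `x`, the maximum of `x` has a single neighbour.
  obtain ⟨x, hx, u, i, hu, hi, hui, v, huv⟩ : ∃ x, G.IsUnitLapEigenvector α x ∧
      ∃ u i, (∀ j, x j ≤ x u) ∧ (∀ j, x i ≤ x j) ∧ 1 < x u - x i ∧ ∃ v, ∀ j, G.Adj u j ↔ j = v := by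
    obtain ⟨u, i, hu, hi, hui⟩ := exists_forall_le_forall_ge hxg
    rcases hx.exists_pendant hα hα2 hu hi hui with h | h
    · exact ⟨x, hx, u, i, hu, hi, hui, h⟩
    · exact ⟨_, hx.neg, i, u, fun j => neg_le_neg (hi j), fun j => neg_le_neg (hu j),
        by linarith, h⟩
  obtain ⟨p, q, hp, hq, hpq⟩ := exists_forall_le_forall_ge hyg
  by_cases hpv : p = v
  · subst hpv
    exact false_of_pendant_of_gap hGH hx hy hα hβ hαβ hα2 hu hi hui huv hp hq hpq
  by_cases hqv : q = v
  · subst hqv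
    exact false_of_pendant_of_gap hGH hx hy.neg hα hβ hαβ hα2 hu hi hui huv
      (fun j => neg_le_neg (hq j)) (fun j => neg_le_neg (hp j)) (by linarith)
  have hp0 := hy.pos_of_forall_le hp
  have hq0 := hy.neg_of_forall_ge hq
  have hadj := hGH.adj_iff
  have hpq' : ¬ H.Adj p q := fun h => by
    have := hy.sub_sq_le h
    nlinarith
  have hne : p ≠ q := by rintro rfl; linarith
  have hH : ∀ {j}, j ≠ v → u ≠ j → H.Adj j u := fun h1 h2 =>
    ((hadj _ _).mpr ⟨h2, fun h => h1 ((huv _).mp h)⟩).symm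
  by_cases hpu : u = p
  · subst hpu
    exact hpq' (hH hqv hne).symm
  by_cases hqu : u = q
  · subst hqu
    exact hpq' (hH hpv hne.symm)
  -- Now `u` is adjacent in `H` both to the maximum and to the minimum of `y`.
  have h1 := hy.mul_le_of_adj_max hp (hH hpv hpu)
  have h2 := hy.le_mul_of_adj_min hq (hH hqv hqu)
  nlinarith

/-- Eigenvectors of complementary graphs for positive eigenvalues of total at most `1` do not both
have values that differ by more than `1`. -/
theorem false_of_gap_of_gap (hGH : IsCompl G H) {x y : V → ℝ} {α β : ℝ}
    (hx : G.IsUnitLapEigenvector α x) (hy : H.IsUnitLapEigenvector β y) (hα : 0 < α)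
    (hβ : 0 < β) (hαβ : α + β ≤ 1) (hxg : ∃ i j, 1 < x i - x j)
    (hyg : ∃ i j, 1 < y i - y j) : False := by
  rcases le_total α (1 / 2) with h | h
  · exact false_of_gap_of_gap_of_le_half hGH hx hy hα hβ hαβ h hxg hyg
  · exact false_of_gap_of_gap_of_le_half hGH.symm hy hx hβ hα (by linarith) (by linarith) hyg hxg

end LargeGaps

/-! ### Orthonormal pairs of vectors of sum zero -/

section Orthonormal

variable {V : Type*} [Fintype V] {x y : V → ℝ}

theorem sum_sum_sub_sq_mul_sub_sq (hx0 : ∑ i, x i = 0) (hx1 : ∑ i, x i ^ 2 = 1)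
    (hy0 : ∑ i, y i = 0) (hy1 : ∑ i, y i ^ 2 = 1) (hxy : ∑ i, x i * y i = 0) :
    ∑ i, ∑ j, (x i - x j) ^ 2 * (y i - y j) ^ 2 =
      2 * (1 + Fintype.card V * ∑ i, x i ^ 2 * y i ^ 2) := by
  obtain ⟨q, hq⟩ : ∃ q : V → ℝ, ∀ i, x i ^ 2 * y i ^ 2 = q i := ⟨_, fun _ => rfl⟩
  have h : ∀ i j, (x i - x j) ^ 2 * (y i - y j) ^ 2 =
      q i + q j + x i ^ 2 * y j ^ 2 + y i ^ 2 * x j ^ 2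
      + 4 * (x i * y i) * (x j * y j) - 2 * (x i ^ 2 * y i) * y j - 2 * (x i * y i ^ 2) * x j
      - 2 * y i * (x j ^ 2 * y j) - 2 * x i * (x j * y j ^ 2) := fun i j => by
    rw [← hq, ← hq]; ring
  simp only [h, hq, Finset.sum_add_distrib, Finset.sum_sub_distrib, ← Finset.mul_sum,
    ← Finset.sum_mul, hx0, hx1, hy0, hy1, hxy, Finset.sum_const, Finset.card_univ, nsmul_eq_mul]
  ring

theorem sq_lt_one_of_sum_eq_zero (hx0 : ∑ i, x i = 0) (hx1 : ∑ i, x i ^ 2 = 1) (i : V) :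
    x i ^ 2 < 1 := by
  classical
  have h0 := Finset.add_sum_erase _ x (Finset.mem_univ i)
  have h1 := Finset.add_sum_erase _ (fun k => x k ^ 2) (Finset.mem_univ i)
  have h2 := sq_sum_le_card_mul_sum_sq (s := Finset.univ.erase i) (f := x)
  rw [show ∑ k ∈ Finset.univ.erase i, x k = - x i by linarith,
    show ∑ k ∈ Finset.univ.erase i, x k ^ 2 = 1 - x i ^ 2 by linarith] at h2
  have h3 : (0 : ℝ) ≤ (Finset.univ.erase i).card := Nat.cast_nonneg _
  by_contra! h
  nlinarith [mul_nonneg h3 (sub_nonneg.mpr h)]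

theorem card_erase_erase_univ [DecidableEq V] {i j : V} (hij : i ≠ j) :
    (((Finset.univ.erase i).erase j).card : ℝ) = Fintype.card V - 2 := by
  have h1 := Finset.card_erase_add_one (Finset.mem_univ i)
  have h2 := Finset.card_erase_add_one (Finset.mem_erase.mpr ⟨hij.symm, Finset.mem_univ j⟩)
  rw [Finset.card_univ] at h1
  rw [← h1, ← h2]
  push_cast
  ring

/-- For a unit vector of sum zero, the excess of `(x i - x j) ^ 2` over `1` in terms of the product
`- x i * x j` and the variance of the other coordinates. -/
theorem card_mul_sub_sq_sub_one [DecidableEq V] (hx0 : ∑ i, x i = 0) (hx1 : ∑ i, x i ^ 2 = 1)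
    {i j : V} (hij : i ≠ j) :
    (Fintype.card V : ℝ) ^ 2 * (x i ^ 2 * x j ^ 2) - (Fintype.card V - 1) * ((x i - x j) ^ 2 - 1) =
      (Fintype.card V * (x i * x j) + 1) ^ 2 +
        ((((Finset.univ.erase i).erase j).card : ℝ) * ∑ k ∈ (Finset.univ.erase i).erase j, x k ^ 2 -
          (∑ k ∈ (Finset.univ.erase i).erase j, x k) ^ 2) := by
  have hj : j ∈ Finset.univ.erase i := Finset.mem_erase.mpr ⟨hij.symm, Finset.mem_univ j⟩
  have h0 := Finset.add_sum_erase _ x (Finset.mem_univ i)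
  have h1 := Finset.add_sum_erase _ (fun k => x k ^ 2) (Finset.mem_univ i)
  rw [← Finset.add_sum_erase _ _ hj] at h0 h1
  have hc := card_erase_erase_univ hij
  have e0 : ∑ k ∈ (Finset.univ.erase i).erase j, x k = - (x i + x j) := by linarith
  have e1 : ∑ k ∈ (Finset.univ.erase i).erase j, x k ^ 2 = 1 - x i ^ 2 - x j ^ 2 := by linarith
  rw [e0, e1, hc]
  ring

theorem card_sub_one_mul_le (hx0 : ∑ i, x i = 0) (hx1 : ∑ i, x i ^ 2 = 1) {i j : V}
    (hij : i ≠ j) :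
    ((Fintype.card V : ℝ) - 1) * ((x i - x j) ^ 2 - 1) ≤
      (Fintype.card V : ℝ) ^ 2 * (x i ^ 2 * x j ^ 2) := by
  classical
  have h := card_mul_sub_sq_sub_one hx0 hx1 hij
  have h1 := sq_sum_le_card_mul_sum_sq (s := (Finset.univ.erase i).erase j) (f := x)
  have h2 := sq_nonneg (Fintype.card V * (x i * x j) + 1)
  linarith

/-- The bound of `card_sub_one_mul_le` is an equality only for the projection of a basis vector, for
which the coordinates other than `i` and `j` equal `x i` or `x j`. -/
theorem card_sub_one_mul_lt (hx0 : ∑ i, x i = 0) (hx1 : ∑ i, x i ^ 2 = 1) {i j v w : V}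
    (hij : 1 < (x i - x j) ^ 2) (hv : (x i - x v) ^ 2 < 1) (hw : (x j - x w) ^ 2 < 1)
    (hvi : v ≠ i) (hwj : w ≠ j) :
    ((Fintype.card V : ℝ) - 1) * ((x i - x j) ^ 2 - 1) <
      (Fintype.card V : ℝ) ^ 2 * (x i ^ 2 * x j ^ 2) := by
  classical
  have hne : i ≠ j := by rintro rfl; simp at hij; linarith
  have hvj : v ≠ j := by rintro rfl; linarith
  have hwi : w ≠ i := by rintro rfl; linarith [sub_sq_comm (x j) (x w)]
  refine lt_of_le_of_ne (card_sub_one_mul_le hx0 hx1 hne) fun heq => ?_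
  have h := card_mul_sub_sq_sub_one hx0 hx1 hne
  set O := (Finset.univ.erase i).erase j
  have h1 := sq_sum_le_card_mul_sum_sq (s := O) (f := x)
  have h2 := sq_nonneg (Fintype.card V * (x i * x j) + 1)
  have hvO : v ∈ O := by simp [O, hvi, hvj]
  have hwO : w ∈ O := by simp [O, hwi, hwj]
  have hm : 0 < (O.card : ℝ) := by exact_mod_cast Finset.card_pos.mpr ⟨v, hvO⟩
  have p1 : (Fintype.card V : ℝ) * (x i * x j) + 1 = 0 := by
    have : (Fintype.card V * (x i * x j) + 1) ^ 2 = 0 := by linarith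
    simpa using this
  have p2 : (O.card : ℝ) * ∑ k ∈ O, x k ^ 2 - (∑ k ∈ O, x k) ^ 2 = 0 := by linarith
  -- The coordinates in `O` have variance zero.
  set s : ℝ := (∑ k ∈ O, x k) / O.card with hs
  have hsum : ∑ k ∈ O, x k = O.card * s := by rw [hs]; field_simp
  have hvar : ∑ k ∈ O, (x k - s) ^ 2 = 0 := by
    have : ∑ k ∈ O, (x k - s) ^ 2 = ∑ k ∈ O, x k ^ 2 - 2 * s * ∑ k ∈ O, x k + O.card * s ^ 2 := by
      rw [Finset.mul_sum, ← nsmul_eq_mul, ← Finset.sum_const, ← Finset.sum_sub_distrib,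
        ← Finset.sum_add_distrib]
      exact Finset.sum_congr rfl fun k _ => by ring
    rw [this, hsum]
    rw [hsum] at p2
    have : (O.card : ℝ) * (∑ k ∈ O, x k ^ 2 - O.card * s ^ 2) = 0 := by linarith
    have := (mul_eq_zero.mp this).resolve_left hm.ne'
    linarith
  have hO : ∀ k ∈ O, x k = s := fun k hk => by
    have := (Finset.sum_eq_zero_iff_of_nonneg fun k _ => sq_nonneg (x k - s)).mp hvar k hk
    exact sub_eq_zero.mp (by simpa using this)
  have hvs := hO v hvO
  have hws := hO w hwO
  have hj : j ∈ Finset.univ.erase i := Finset.mem_erase.mpr ⟨hne.symm, Finset.mem_univ j⟩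
  have hc : (O.card : ℝ) = Fintype.card V - 2 := card_erase_erase_univ hne
  have e0 := Finset.add_sum_erase _ x (Finset.mem_univ i)
  have e1 := Finset.add_sum_erase _ (fun k => x k ^ 2) (Finset.mem_univ i)
  rw [← Finset.add_sum_erase _ _ hj, hx0, hsum] at e0
  rw [← Finset.add_sum_erase _ _ hj, hx1, Finset.sum_congr rfl fun k hk => by rw [hO k hk],
    Finset.sum_const, nsmul_eq_mul] at e1
  rw [hc] at e0 e1 hm
  set n : ℝ := (Fintype.card V : ℝ)
  have f1 : (n - 2) * (n * ((n - 1) * s ^ 2) - 1) = 0 := by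
    have e2 : (x i + x j) ^ 2 = ((n - 2) * s) ^ 2 := by
      rw [show x i + x j = -((n - 2) * s) by linarith, neg_sq]
    linear_combination 2 * p1 - n * e2 + n * e1
  have f2 := (mul_eq_zero.mp f1).resolve_left hm.ne'
  have f3 : n * ((x i - s) * (s - x j)) = 0 := by
    linear_combination (-1) * p1 - f2 + n * s * e0
  rcases mul_eq_zero.mp ((mul_eq_zero.mp f3).resolve_left (by linarith)) with h | h
  · rw [hws, ← sub_eq_zero.mp h, sub_sq_comm] at hw
    linarith
  · rw [hvs, sub_eq_zero.mp h] at hv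
    linarith

/-- For `x` of sum zero and orthogonal to `y`, the square of `∑ x j ^ 2 * (y c - y j)` is small by
the Cauchy–Schwarz inequality, so that `y` may be recentred at `c`. -/
theorem card_mul_sum_sq_mul_sub_sq_le (hx0 : ∑ i, x i = 0) (hx1 : ∑ i, x i ^ 2 = 1)
    (hxy : ∑ i, x i * y i = 0) (hn : 2 ≤ Fintype.card V) (c : V) :
    Fintype.card V * (x c ^ 2 * ∑ j, x j ^ 2 * (y c - y j) ^ 2) ≤
      ((Fintype.card V : ℝ) - 1) * ∑ j, x j ^ 2 * y j ^ 2 := by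
  classical
  have hn1 : (0 : ℝ) < (Fintype.card V : ℝ) - 1 := by
    have : (2 : ℝ) ≤ Fintype.card V := by exact_mod_cast hn
    linarith
  have hcard : ((Finset.univ.erase c).card : ℝ) = Fintype.card V - 1 := by
    rw [← Finset.card_univ, ← Finset.card_erase_add_one (Finset.mem_univ c)]
    push_cast
    ring
  set n : ℝ := (Fintype.card V : ℝ)
  set m : ℝ := - x c / (n - 1)
  set A : ℝ := ∑ j, x j ^ 2 * (y c - y j)
  set R : ℝ := ∑ j, x j ^ 2 * (y c - y j) ^ 2
  have hm : (n - 1) * m = - x c := by simp only [m]; field_simp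
  have e0 := Finset.add_sum_erase _ x (Finset.mem_univ c)
  have e1 := Finset.add_sum_erase _ (fun k => x k ^ 2) (Finset.mem_univ c)
  have hlin : ∑ j, x j * (y c - y j) = 0 := by
    simp only [mul_sub, Finset.sum_sub_distrib, ← Finset.sum_mul, hx0, hxy]; ring
  have hA : A = ∑ j ∈ Finset.univ.erase c, (x j - m) * (x j * (y c - y j)) := by
    have h1 : A = ∑ j, (x j - m) * (x j * (y c - y j)) := by
      have : ∀ j, (x j - m) * (x j * (y c - y j)) =
          x j ^ 2 * (y c - y j) - m * (x j * (y c - y j)) := fun j => by ring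
      simp only [this, Finset.sum_sub_distrib, ← Finset.mul_sum, hlin, A]; ring
    rw [h1, ← Finset.add_sum_erase _ _ (Finset.mem_univ c)]
    simp
  have hR : R = ∑ j ∈ Finset.univ.erase c, (x j * (y c - y j)) ^ 2 := by
    simp only [R]
    rw [← Finset.add_sum_erase _ _ (Finset.mem_univ c)]
    simp [mul_pow]
  have hM : (n - 1) * ∑ j ∈ Finset.univ.erase c, (x j - m) ^ 2 = n - 1 - n * x c ^ 2 := by
    have h1 : ∑ j ∈ Finset.univ.erase c, (x j - m) ^ 2 =
        ∑ j ∈ Finset.univ.erase c, x j ^ 2 - 2 * m * ∑ j ∈ Finset.univ.erase c, x j +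
          (n - 1) * m ^ 2 := by
      rw [Finset.mul_sum, ← hcard, ← nsmul_eq_mul, ← Finset.sum_const, ← Finset.sum_sub_distrib,
        ← Finset.sum_add_distrib]
      exact Finset.sum_congr rfl fun k _ => by ring
    have h2 : ∑ j ∈ Finset.univ.erase c, x j = - x c := by linarith
    have h3 : ∑ j ∈ Finset.univ.erase c, x j ^ 2 = 1 - x c ^ 2 := by linarith
    rw [h1, h2, h3]
    linear_combination ((n - 1) * m + x c) * hm
  have hCS : A ^ 2 ≤ (∑ j ∈ Finset.univ.erase c, (x j - m) ^ 2) * R := by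
    rw [hA, hR]
    exact Finset.sum_mul_sq_le_sq_mul_sq _ _ _
  have hQ : ∑ j, x j ^ 2 * y j ^ 2 = y c ^ 2 - 2 * y c * A + R := by
    have h1 : ∀ j, x j ^ 2 * y j ^ 2 = y c ^ 2 * x j ^ 2 - 2 * y c * (x j ^ 2 * (y c - y j)) +
        x j ^ 2 * (y c - y j) ^ 2 := fun j => by ring
    simp only [h1, Finset.sum_add_distrib, Finset.sum_sub_distrib, ← Finset.mul_sum, hx1]
    ring
  rw [hQ]
  have h2 : (n - 1) * A ^ 2 ≤ (n - 1 - n * x c ^ 2) * R := by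
    rw [← hM, mul_assoc]
    exact mul_le_mul_of_nonneg_left hCS hn1.le
  have h3 : 0 ≤ (n - 1) * (y c - A) ^ 2 := mul_nonneg hn1.le (sq_nonneg _)
  linarith

/-- Two disjoint pairs cannot both have gap larger than `1`, hence the pairs with this property all
contain a common vertex. -/
theorem exists_star_center (hx1 : ∑ i, x i ^ 2 = 1) [Nonempty V] :
    ∃ c, ∀ i j, 1 < (x i - x j) ^ 2 → i = c ∨ j = c := by
  classical
  have hsub : ∀ S : Finset V, ∑ i ∈ S, x i ^ 2 ≤ 1 := fun S =>
    hx1 ▸ Finset.sum_le_sum_of_subset_of_nonneg (Finset.subset_univ S) fun _ _ _ => sq_nonneg _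
  have hdisj : ∀ a b c d : V, 1 < x a - x b → 1 < x c - x d → a = c ∨ b = d := by
    intro a b c d hab hcd
    by_contra! h
    by_cases had : a = d
    · -- Here `x c - x b` would exceed `2`.
      subst had
      have hbc : b ≠ c := by rintro rfl; linarith
      have := hsub {b, c}
      rw [Finset.sum_pair hbc] at this
      nlinarith [sq_nonneg (x b + x c)]
    by_cases hbc : b = c
    · subst hbc
      have := hsub {a, d}
      rw [Finset.sum_pair had] at this
      nlinarith [sq_nonneg (x a + x d)]
    have h1 : a ≠ b := by rintro rfl; linarith
    have h2 : c ≠ d := by rintro rfl; linarith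
    have := hsub {a, b, c, d}
    rw [Finset.sum_insert (by simp [h1, h.1, had]), Finset.sum_insert (by simp [hbc, h.2]),
      Finset.sum_pair h2] at this
    nlinarith [sq_nonneg (x a + x b), sq_nonneg (x c + x d)]
  have key : ∃ c, ∀ i j, 1 < x i - x j → i = c ∨ j = c := by
    by_cases h0 : ∃ a b, 1 < x a - x b
    · obtain ⟨a, b, hab⟩ := h0
      by_cases h1 : ∃ i j, 1 < x i - x j ∧ i ≠ a
      · obtain ⟨i, j, hij, hia⟩ := h1
        have hjb : j = b := ((hdisj i j a b hij hab).resolve_left hia)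
        subst hjb
        refine ⟨j, fun k l hkl => ?_⟩
        rcases hdisj k l a j hkl hab with rfl | h
        · exact (hdisj k l i j hkl hij).imp (fun h => absurd h.symm hia) id
        · exact .inr h
      · push Not at h1
        exact ⟨a, fun i j hij => .inl (h1 i j hij)⟩
    · push Not at h0
      exact ⟨Classical.arbitrary V, fun i j hij => absurd hij (h0 i j).not_gt⟩
  obtain ⟨c, hc⟩ := key
  refine ⟨c, fun i j hij => ?_⟩
  rcases le_total (x j) (x i) with h | h
  · exact hc i j (by nlinarith)
  · exact (hc j i (by nlinarith)).symm

end Orthonormal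

/-! ### At most one eigenvector with gaps larger than one -/

section SmallGaps

variable {V : Type*} [Fintype V] {G H : SimpleGraph V} [DecidableRel G.Adj] [DecidableRel H.Adj]
  {x y : V → ℝ} {α β : ℝ}

theorem IsUnitLapEigenvector.sum_mul_eq_zero (hGH : IsCompl G H)
    (hx : G.IsUnitLapEigenvector α x) (hy : H.IsUnitLapEigenvector β y)
    (hαβ : α + β ≠ Fintype.card V) : ∑ i, x i * y i = 0 := by
  classical
  have h1 : ∀ i, ∑ j ∈ G.neighborFinset i, (y i - y j) = (Fintype.card V - β) * y i := by
    intro i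
    have h2 : ∑ j, (y i - y j) = Fintype.card V * y i := by
      simp [Finset.sum_sub_distrib, hy.sum_eq_zero]
    have h3 : ∑ j, (y i - y j) =
        ∑ j ∈ G.neighborFinset i, (y i - y j) + ∑ j ∈ H.neighborFinset i, (y i - y j) := by
      simp only [neighborFinset_eq_filter, Finset.sum_filter, ← Finset.sum_add_distrib]
      refine Finset.sum_congr rfl fun j _ => ?_
      have := hGH.adj_iff i j
      by_cases hij : i = j
      · subst hij; simp
      · by_cases h : G.Adj i j <;> simp_all
    rw [hy.sum_neighbor] at h3
    linarith
  have h2 := G.dotProduct_lapMatrix_mulVec_comm x y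
  simp only [dotProduct, lapMatrix_mulVec_eq_sum_sub, h1, hx.sum_neighbor] at h2
  have h3 : (Fintype.card V - β) * ∑ i, x i * y i = α * ∑ i, x i * y i := by
    rw [Finset.mul_sum, Finset.mul_sum]
    refine Eq.trans (Finset.sum_congr rfl fun i _ => ?_)
      (h2.trans (Finset.sum_congr rfl fun i _ => ?_)) <;> ring
  have h4 : (α + β - Fintype.card V) * ∑ i, x i * y i = 0 := by linarith
  exact (mul_eq_zero.mp h4).resolve_left (sub_ne_zero.mpr hαβ)

/-- If `y` has no gap larger than `1`, then on each edge of `G` the energy of `x` is at least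
`(x i - x j) ^ 2 * (y i - y j) ^ 2`. On an edge of `H` the corresponding bound fails only if
`x` has a gap larger than `1`; such edges form a star, and the total loss on it is smaller
than the surplus `n * ∑ x i ^ 2 * y i ^ 2`. -/
theorem false_of_no_gap (hGH : IsCompl G H) (hx : G.IsUnitLapEigenvector α x)
    (hy : H.IsUnitLapEigenvector β y) (hn : 2 ≤ Fintype.card V) (hα : 0 < α) (hβ : 0 < β)
    (hαβ : α + β ≤ 1) (hyg : ∀ i j, (y i - y j) ^ 2 ≤ 1) : False := by
  classical
  have hn2 : (2 : ℝ) ≤ Fintype.card V := by exact_mod_cast hn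
  have hxy := hx.sum_mul_eq_zero hGH hy (by linarith)
  have hP := sum_sum_sub_sq_mul_sub_sq hx.sum_eq_zero hx.sum_sq hy.sum_eq_zero hy.sum_sq hxy
  rw [← hGH.sum_adj_add_sum_adj _ (by simp)] at hP
  have hα' := hx.dirichletEnergy_eq
  have hβ' := hy.dirichletEnergy_eq
  rw [dirichletEnergy, div_eq_iff two_ne_zero] at hα' hβ'
  have hG : ∀ i j, (if G.Adj i j then (x i - x j) ^ 2 * (y i - y j) ^ 2 else 0) ≤
      if G.Adj i j then (x i - x j) ^ 2 else 0 := fun i j => by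
    split_ifs
    · exact mul_le_of_le_one_right (sq_nonneg _) (hyg i j)
    · exact le_rfl
  have hGsum := Finset.sum_le_sum fun i (_ : i ∈ Finset.univ) =>
    Finset.sum_le_sum fun j (_ : j ∈ Finset.univ) => hG i j
  have hQ0 : 0 ≤ ∑ i, x i ^ 2 * y i ^ 2 := Finset.sum_nonneg fun i _ => by positivity
  have : Nonempty V := Fintype.card_pos_iff.mp (by lia)
  obtain ⟨c, hc⟩ := exists_star_center hx.sum_sq
  by_cases hbad : ∃ j, 1 < (x c - x j) ^ 2 ∧ y c ≠ y j
  · obtain ⟨j₀, hj₀, hyj₀⟩ := hbad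
    set B : V → ℝ := fun j => max 0 ((x c - x j) ^ 2 - 1) * (y c - y j) ^ 2
    have hB0 : ∀ j, 0 ≤ B j := fun j => mul_nonneg (le_max_left _ _) (sq_nonneg _)
    have hH : ∀ i j, (if H.Adj i j then (x i - x j) ^ 2 * (y i - y j) ^ 2 else 0) ≤
        (if H.Adj i j then (y i - y j) ^ 2 else 0) +
          ((if i = c then B j else 0) + if j = c then B i else 0) := by
      intro i j
      have t1 : 0 ≤ if i = c then B j else 0 := by split_ifs <;> simp [hB0]
      have t2 : 0 ≤ if j = c then B i else 0 := by split_ifs <;> simp [hB0]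
      by_cases h : H.Adj i j
      · rw [if_pos h, if_pos h]
        rcases le_or_gt ((x i - x j) ^ 2) 1 with hij | hij
        · linarith [mul_le_of_le_one_left (sq_nonneg (y i - y j)) hij]
        · rcases hc i j hij with rfl | rfl
          · have : B j = ((x i - x j) ^ 2 - 1) * (y i - y j) ^ 2 := by
              simp only [B]; rw [max_eq_right (by linarith)]
            rw [if_pos rfl, this]
            linarith
          · have : B i = ((x i - x j) ^ 2 - 1) * (y i - y j) ^ 2 := by
              simp only [B]
              rw [sub_sq_comm (x j), sub_sq_comm (y j), max_eq_right (by linarith)]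
            rw [if_pos rfl, this]
            linarith
      · rw [if_neg h, if_neg h]
        linarith
    have hHsum := Finset.sum_le_sum fun i (_ : i ∈ Finset.univ) =>
      Finset.sum_le_sum fun j (_ : j ∈ Finset.univ) => hH i j
    simp only [Finset.sum_add_distrib, Finset.sum_ite_irrel, Finset.sum_const_zero,
      Finset.sum_ite_eq', Finset.mem_univ, if_true] at hHsum
    have hlt : ((Fintype.card V : ℝ) - 1) * ∑ j, B j <
        (Fintype.card V : ℝ) ^ 2 * (x c ^ 2 * ∑ j, x j ^ 2 * (y c - y j) ^ 2) := by
      have hterm : ∀ j, ((Fintype.card V : ℝ) - 1) * B j ≤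
          (Fintype.card V : ℝ) ^ 2 * (x c ^ 2 * (x j ^ 2 * (y c - y j) ^ 2)) := by
        intro j
        rcases le_or_gt ((x c - x j) ^ 2) 1 with h | h
        · have : B j = 0 := by simp only [B]; rw [max_eq_left (by linarith), zero_mul]
          rw [this, mul_zero]; positivity
        · have hcj : c ≠ j := by rintro rfl; simp at h; linarith
          have := mul_le_mul_of_nonneg_right
            (card_sub_one_mul_le hx.sum_eq_zero hx.sum_sq hcj) (sq_nonneg (y c - y j))
          simp only [B]
          rw [max_eq_right (by linarith)]
          linarith
      rw [Finset.mul_sum, Finset.mul_sum, Finset.mul_sum]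
      refine Finset.sum_lt_sum (fun j _ => hterm j) ⟨j₀, Finset.mem_univ _, ?_⟩
      have hcj : c ≠ j₀ := fun h => hyj₀ (congrArg y h)
      have hle := card_sub_one_mul_le hx.sum_eq_zero hx.sum_sq hcj
      have hpos : 0 < ((Fintype.card V : ℝ) - 1) * ((x c - x j₀) ^ 2 - 1) :=
        mul_pos (by linarith) (by linarith)
      obtain ⟨v, hv⟩ := hx.exists_adj hα.ne' (u := c) fun h => by
        rw [h] at hle hpos; simp at hle hpos; linarith
      obtain ⟨w, hw⟩ := hx.exists_adj hα.ne' (u := j₀) fun h => by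
        rw [h] at hle hpos; simp at hle hpos; linarith
      have hy2 : 0 < (y c - y j₀) ^ 2 := pow_two_pos_of_ne_zero (sub_ne_zero.mpr hyj₀)
      have := mul_lt_mul_of_pos_right (card_sub_one_mul_lt hx.sum_eq_zero hx.sum_sq hj₀
        ((hx.sub_sq_le hv).trans_lt (by linarith)) ((hx.sub_sq_le hw).trans_lt (by linarith))
        hv.ne' hw.ne') hy2
      simp only [B]
      rw [max_eq_right (by linarith)]
      linarith
    have hrec := mul_le_mul_of_nonneg_left
      (card_mul_sum_sq_mul_sub_sq_le hx.sum_eq_zero hx.sum_sq hxy hn c)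
      (Nat.cast_nonneg (Fintype.card V) : (0 : ℝ) ≤ Fintype.card V)
    have hBlt : ∑ j, B j < Fintype.card V * ∑ i, x i ^ 2 * y i ^ 2 := by
      refine lt_of_mul_lt_mul_left (a := (Fintype.card V : ℝ) - 1) ?_ (by linarith)
      linarith
    linarith
  -- No loss occurs, so all inequalities are equalities, and `x` and `y` have disjoint supports.
  · push Not at hbad
    have hbad' : ∀ i j, 1 < (x i - x j) ^ 2 → y i = y j := by
      intro i j hij
      rcases hc i j hij with rfl | rfl
      · exact hbad j hij
      · exact (hbad i (by rwa [sub_sq_comm])).symm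
    have hH : ∀ i j, (if H.Adj i j then (x i - x j) ^ 2 * (y i - y j) ^ 2 else 0) ≤
        if H.Adj i j then (y i - y j) ^ 2 else 0 := by
      intro i j
      split_ifs
      · rcases le_or_gt ((x i - x j) ^ 2) 1 with hij | hij
        · exact mul_le_of_le_one_left (sq_nonneg _) hij
        · simp [hbad' i j hij]
      · exact le_rfl
    have hHsum := Finset.sum_le_sum fun i (_ : i ∈ Finset.univ) =>
      Finset.sum_le_sum fun j (_ : j ∈ Finset.univ) => hH i j
    have hnQ : 0 ≤ Fintype.card V * ∑ i, x i ^ 2 * y i ^ 2 := by positivity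
    have hQ : ∑ i, x i ^ 2 * y i ^ 2 = 0 := by nlinarith
    have hz : ∀ i, x i ^ 2 * y i ^ 2 = 0 := fun i =>
      (Finset.sum_eq_zero_iff_of_nonneg fun i _ => by positivity).mp hQ i (Finset.mem_univ i)
    have hGeq := (Finset.sum_eq_sum_iff_of_le fun i (_ : i ∈ Finset.univ) =>
      Finset.sum_le_sum fun j (_ : j ∈ Finset.univ) => hG i j).mp (by linarith)
    have hHeq := (Finset.sum_eq_sum_iff_of_le fun i (_ : i ∈ Finset.univ) =>
      Finset.sum_le_sum fun j (_ : j ∈ Finset.univ) => hH i j).mp (by linarith)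
    obtain ⟨i, hi⟩ : ∃ i, x i ≠ 0 := by
      by_contra! h; simpa [h] using hx.sum_sq
    obtain ⟨j, hj⟩ : ∃ j, y j ≠ 0 := by
      by_contra! h; simpa [h] using hy.sum_sq
    have hyi : y i = 0 := by simpa [hi] using hz i
    have hxj : x j = 0 := by simpa [hj] using hz j
    have hij : i ≠ j := by rintro rfl; exact hi hxj
    by_cases h : G.Adj i j
    · have := (Finset.sum_eq_sum_iff_of_le fun j (_ : j ∈ Finset.univ) => hG i j).mp
        (hGeq i (Finset.mem_univ i)) j (Finset.mem_univ j)
      rw [if_pos h, if_pos h, hyi, hxj, sub_zero, zero_sub, neg_sq] at this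
      have h1 := (mul_eq_left₀ (pow_ne_zero 2 hi)).mp this
      exact (sq_lt_one_of_sum_eq_zero hy.sum_eq_zero hy.sum_sq j).ne h1
    · have h' := (hGH.adj_iff i j).mpr ⟨hij, h⟩
      have := (Finset.sum_eq_sum_iff_of_le fun j (_ : j ∈ Finset.univ) => hH i j).mp
        (hHeq i (Finset.mem_univ i)) j (Finset.mem_univ j)
      rw [if_pos h', if_pos h', hyi, hxj, sub_zero, zero_sub, neg_sq] at this
      have h1 := (mul_eq_right₀ (pow_ne_zero 2 hj)).mp this
      exact (sq_lt_one_of_sum_eq_zero hx.sum_eq_zero hx.sum_sq i).ne h1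

theorem one_lt_add_of_pos (hGH : IsCompl G H) (hx : G.IsUnitLapEigenvector α x)
    (hy : H.IsUnitLapEigenvector β y) (hn : 2 ≤ Fintype.card V) (hα : 0 < α) (hβ : 0 < β) :
    1 < α + β := by
  by_contra! hαβ
  have hsq : ∀ z : V → ℝ, (¬ ∃ i j, 1 < z i - z j) → ∀ i j, (z i - z j) ^ 2 ≤ 1 := by
    intro z hz i j
    push Not at hz
    have h1 := hz i j
    have h2 := hz j i
    nlinarith
  by_cases hyg : ∃ i j, 1 < y i - y j
  · by_cases hxg : ∃ i j, 1 < x i - x j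
    · exact false_of_gap_of_gap hGH hx hy hα hβ hαβ hxg hyg
    · exact false_of_no_gap hGH.symm hy hx hn hβ hα (by linarith) (hsq x hxg)
  · exact false_of_no_gap hGH hx hy hn hα hβ hαβ (hsq y hyg)

/-- Equality in the bound for the sum forces one of the two eigenvalues to vanish. -/
theorem one_le_add_and_eq_iff [DecidableEq V] (hGH : IsCompl G H) (hn : 2 ≤ Fintype.card V) :
    1 ≤ G.algConnectivity hn + H.algConnectivity hn ∧
      (G.algConnectivity hn + H.algConnectivity hn = 1 ↔
        G.IsJoinVertexDisconnected ∨ H.IsJoinVertexDisconnected) := by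
  obtain ⟨x, hx⟩ := G.exists_isUnitLapEigenvector_algConnectivity hn
  obtain ⟨y, hy⟩ := H.exists_isUnitLapEigenvector_algConnectivity hn
  have hrev : ∀ {G H : SimpleGraph V} [DecidableRel G.Adj] [DecidableRel H.Adj], IsCompl G H →
      H.IsJoinVertexDisconnected → G.algConnectivity hn + H.algConnectivity hn ≤ 1 := by
    intro G H _ _ hGH hH
    obtain ⟨⟨c, hc⟩, h1⟩ := hH.algConnectivity_le_one hn
    rw [algConnectivity_eq_zero_of_isolated (G := G) hn (c := c) fun j h =>
      ((hGH.adj_iff c j).mp (hc j h.ne')).2 h, zero_add]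
    exact h1
  rcases (G.algConnectivity_nonneg hn).eq_or_lt with hα | hα
  · rw [← hα] at hx
    obtain ⟨h1, h2⟩ := one_le_of_eigenvalue_zero hGH hx hy
    refine ⟨by linarith, fun h => .inr (h2 (by linarith)), fun h => le_antisymm ?_ (by linarith)⟩
    rcases h with h | h
    · rw [add_comm]; exact hrev hGH.symm h
    · exact hrev hGH h
  rcases (H.algConnectivity_nonneg hn).eq_or_lt with hβ | hβ
  · rw [← hβ] at hy
    obtain ⟨h1, h2⟩ := one_le_of_eigenvalue_zero hGH.symm hy hx
    refine ⟨by linarith, fun h => .inl (h2 (by linarith)), fun h => le_antisymm ?_ (by linarith)⟩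
    rcases h with h | h
    · rw [add_comm]; exact hrev hGH.symm h
    · exact hrev hGH h
  · have h := one_lt_add_of_pos hGH hx hy hn hα hβ
    refine ⟨h.le, fun h' => absurd h' h.ne', fun h' => le_antisymm ?_ h.le⟩
    rcases h' with h' | h'
    · rw [add_comm]; exact hrev hGH.symm h'
    · exact hrev hGH h'

end SmallGaps

end SimpleGraph

theorem theorem1 {V : Type*} [Fintype V] [DecidableEq V] (G : SimpleGraph V)
    [DecidableRel G.Adj] (hn : 2 ≤ Fintype.card V) :
    1 ≤ G.algConnectivity hn + Gᶜ.algConnectivity hn ∧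
    (G.algConnectivity hn + Gᶜ.algConnectivity hn = 1 ↔
      G.IsJoinVertexDisconnected ∨ Gᶜ.IsJoinVertexDisconnected) ∧
    G.lapSpread hn ≤ (Fintype.card V : ℝ) - 1 := by
  obtain ⟨h1, h2⟩ := SimpleGraph.one_le_add_and_eq_iff (isCompl_compl (x := G)) hn
  exact ⟨h1, h2, (G.lapSpread_le hn isCompl_compl).trans (by linarith)⟩
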